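/- Let $d\ge 1$ and, for $\hbar>0$, let $\widehat H_\hbar=\sum_{j=1}^d\left(-\frac{\hbar^2}{2}\frac{\partial^2}{\partial x_j^2}+\frac{x_j^2}{2}\right)$ be the isotropic harmonic oscillator on $L^2(\mathbb R^d)$, with eigenvalues $E_N(\hbar)=\hbar(N+\frac d2)$, $N=0,1,2,\dots$. Let $\Pi_{\hbar,E_N(\hbar)}(x,y)$ be the (continuous) Schwartz kernel of the orthogonal projection of $L^2(\mathbb R^d)$ onto the eigenspace $\{\psi\in L^2(\mathbb R^d):\widehat H_\hbar\psi=E_N(\hbar)\psi\}$, and let $$W_{\hbar,E_N(\hbar)}(x,\xi)=\int_{\mathbb R^d}\Pi_{\hbar,E_N(\hbar)}\left(x+\tfrac v2,x-\tfrac v2\right)e^{-\frac i\hbar v\cdot\xi}\,\frac{dv}{(2\pi\hbar)^d}$$ be its Wigner distribution. For fixed real numbers $E_1<E_2$ put $$W_{\hbar,[E_1,E_2]}(x,\xi)=\sum_{N:\,E_N(\hbar)\in[E_1,E_2]}W_{\hbar,E_N(\hbar)}(x,\xi),\qquad H(x,\xi)=\tfrac12\left(\|x\|^2+\|\xi\|^2\right).$$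 Then for every fixed $(x,\xi)\in\mathbb R^d\times\mathbb R^d$ with $H(x,\xi)>0$, as $\hbar\to0^+$: (i) if $E_1<H(x,\xi)<E_2$, then $W_{\hbar,[E_1,E_2]}(x,\xi)=(2\pi\hbar)^{-d}\left(1+O(\hbar^{1/2})\right)$; (ii) if $H(x,\xi)<E_1$, then $W_{\hbar,[E_1,E_2]}(x,\xi)=O(\hbar^{-d+1/2})$; (iii) if $H(x,\xi)>E_2$, then $W_{\hbar,[E_1,E_2]}(x,\xi)=O(\hbar^\infty)$, that is, $O(\hbar^n)$ for every $n\in\mathbb N$. The implied constants may depend on $d,E_1,E_2,(x,\xi)$ and, in (iii), on $n$. -/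

import Mathlib

open MeasureTheory Asymptotics Filter Topology
open scoped SchwartzMap LineDeriv

namespace WignerOsc

noncomputable section

/-- Position space (and momentum space) `ℝᵈ` with its Euclidean structure. -/
abbrev Rd (d : ℕ) : Type := EuclideanSpace ℝ (Fin d)

/-- The Hilbert space `L²(ℝᵈ, dx)` of complex-valued functions. -/
abbrev L2 (d : ℕ) : Type := Lp ℂ 2 (volume : Measure (Rd d))

/-- The isotropic harmonic oscillator `∑ⱼ (-(ħ²/2) ∂²/∂xⱼ² + xⱼ²/2)` acting on Schwartz functions. -/
def oscillator (d : ℕ) (ħ : ℝ) (φ : 𝓢(Rd d, ℂ)) : 𝓢(Rd d, ℂ) :=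
  ∑ j : Fin d,
    ((-(ħ ^ 2 / 2)) • ∂_{EuclideanSpace.single j (1 : ℝ)} (∂_{EuclideanSpace.single j (1 : ℝ)} φ)
      + SchwartzMap.smulLeftCLM ℂ (fun x : Rd d => x j ^ 2 / 2) φ)

/-- The pointwise formula for the oscillator. -/
theorem oscillator_apply (d : ℕ) (ħ : ℝ) (φ : 𝓢(Rd d, ℂ)) (x : Rd d) :
    oscillator d ħ φ x =
      ∑ j : Fin d,
        (-((ħ : ℂ) ^ 2 / 2) *
            lineDeriv ℝ (fun y => lineDeriv ℝ φ y (EuclideanSpace.single j 1)) x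
              (EuclideanSpace.single j 1)
          + ((x j : ℂ) ^ 2 / 2) * φ x) := by
  have hg : ∀ j : Fin d, (fun x : Rd d => x j ^ 2 / 2).HasTemperateGrowth := by
    intro j
    have h : (fun x : Rd d => x j).HasTemperateGrowth :=
      (EuclideanSpace.proj (𝕜 := ℝ) j).hasTemperateGrowth
    have h2 := (h.mul h).mul (Function.HasTemperateGrowth.const (2⁻¹ : ℝ))
    have h3 : (fun x : Rd d => x j ^ 2 / 2) =
        ((fun x : Rd d => x j) * fun x : Rd d => x j) * fun _ : Rd d => (2⁻¹ : ℝ) := by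
      funext x
      simp only [Pi.mul_apply]
      ring
    rw [h3]
    exact h2
  simp only [oscillator, sum_apply, add_apply, smul_apply,
    SchwartzMap.lineDerivOp_apply, SchwartzMap.smulLeftCLM_apply_apply (hg _)]
  refine Finset.sum_congr rfl fun j _ => ?_
  congr 1
  · rw [Complex.real_smul]
    push_cast
    congr 3
    funext y
    exact SchwartzMap.lineDerivOp_apply _ φ y
  · rw [Complex.real_smul]
    push_cast
    rfl

/-- The eigenspace `{ψ ∈ L²(ℝᵈ) : Ĥψ = E ψ}`. The equation is meant in the sense of distributions,
`⟨Ĥφ, ψ⟩ = E ⟨φ, ψ⟩` for all Schwartz functions `φ`, which is the eigenvalue equation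
for the self-adjoint realization of the oscillator. -/
def eigenspace (d : ℕ) (ħ E : ℝ) : Submodule ℂ (L2 d) where
  carrier := {ψ | ∀ φ : 𝓢(Rd d, ℂ),
    inner ℂ ((oscillator d ħ φ).toLp 2 : L2 d) ψ = (E : ℂ) * inner ℂ (φ.toLp 2 : L2 d) ψ}
  add_mem' := by
    intro a b ha hb φ
    rw [inner_add_right, inner_add_right, ha φ, hb φ, mul_add]
  zero_mem' := by
    intro φ
    simp
  smul_mem' := by
    intro c a ha φ
    rw [inner_smul_right, inner_smul_right, ha φ]
    ring

theorem isClosed_eigenspace (d : ℕ) (ħ E : ℝ) :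
    IsClosed (eigenspace d ħ E : Set (L2 d)) := by
  have : (eigenspace d ħ E : Set (L2 d)) = ⋂ φ : 𝓢(Rd d, ℂ), {ψ : L2 d |
      inner ℂ ((oscillator d ħ φ).toLp 2 : L2 d) ψ = (E : ℂ) * inner ℂ (φ.toLp 2 : L2 d) ψ} := by
    ext ψ
    simp only [Set.mem_iInter]
    rfl
  rw [this]
  exact isClosed_iInter fun φ => isClosed_eq (by fun_prop) (by fun_prop)

instance instHasOrthogonalProjectionEigenspace (d : ℕ) (ħ E : ℝ) :
    (eigenspace d ħ E).HasOrthogonalProjection := by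
  have : CompleteSpace (eigenspace d ħ E) := (isClosed_eigenspace d ħ E).completeSpace_coe
  infer_instance

/-- The orthogonal projection of `L²(ℝᵈ)` onto the eigenspace, as an operator on `L²(ℝᵈ)`. -/
def eigenProjection (d : ℕ) (ħ E : ℝ) : L2 d →L[ℂ] L2 d :=
  (eigenspace d ħ E).starProjection

/-- `K` is a continuous integral (Schwartz) kernel of `T`: `(T f)(x) = ∫ K(x, y) f(y) dy`. -/
def IsContinuousKernel {d : ℕ} (T : L2 d →L[ℂ] L2 d) (K : Rd d → Rd d → ℂ) : Prop :=
  Continuous (fun p : Rd d × Rd d => K p.1 p.2) ∧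
    ∀ f : L2 d, ∀ᵐ x : Rd d,
      Integrable (fun y => K x y * f y) ∧ T f x = ∫ y, K x y * f y

/-- An operator has at most one continuous kernel. -/
theorem IsContinuousKernel.unique {d : ℕ} {T : L2 d →L[ℂ] L2 d} {K K' : Rd d → Rd d → ℂ}
    (hK : IsContinuousKernel T K) (hK' : IsContinuousKernel T K') : K = K' := by
  by_contra hne
  obtain ⟨x₀, hx₀⟩ := Function.ne_iff.mp hne
  obtain ⟨y₀, hy₀⟩ := Function.ne_iff.mp hx₀
  set c : ℂ := K x₀ y₀ - K' x₀ y₀ with hc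
  have hc0 : 0 < ‖c‖ := norm_pos_iff.mpr (sub_ne_zero.mpr hy₀)
  have hcont : Continuous (fun p : Rd d × Rd d => K p.1 p.2 - K' p.1 p.2) := hK.1.sub hK'.1
  obtain ⟨r, hr, hball⟩ := Metric.continuous_iff.mp hcont (x₀, y₀) (‖c‖ / 2) (by positivity)
  have hfin : volume (Metric.ball y₀ r) ≠ ⊤ := measure_ball_lt_top.ne
  let f : L2 d := indicatorConstLp 2 measurableSet_ball hfin (1 : ℂ)
  have hf : (f : Rd d → ℂ) =ᵐ[volume] (Metric.ball y₀ r).indicator fun _ => (1 : ℂ) :=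
    indicatorConstLp_coeFn
  have hae := (hK.2 f).and (hK'.2 f)
  have hpos : volume (Metric.ball x₀ r) ≠ 0 := (Metric.measure_ball_pos _ _ hr).ne'
  obtain ⟨x, hxr, ⟨hi, he⟩, hi', he'⟩ : ∃ x ∈ Metric.ball x₀ r,
      (Integrable (fun y => K x y * f y) ∧ T f x = ∫ y, K x y * f y) ∧
      (Integrable (fun y => K' x y * f y) ∧ T f x = ∫ y, K' x y * f y) := by
    by_contra hcon
    push Not at hcon
    apply hpos
    refine measure_mono_null (fun x hx => ?_) (ae_iff.mp hae)
    exact fun h => hcon x hx h.1 h.2.1 h.2.2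
  have key : ∀ L : Rd d → ℂ, (∫ y, L y * f y) = ∫ y in Metric.ball y₀ r, L y := by
    intro L
    rw [← integral_indicator measurableSet_ball]
    refine integral_congr_ae ?_
    filter_upwards [hf] with y hy
    rw [hy]
    by_cases h : y ∈ Metric.ball y₀ r <;> simp [h]
  have hzero : ∫ y in Metric.ball y₀ r, (K x y - K' x y) = 0 := by
    rw [← key]
    simp only [sub_mul]
    rw [integral_sub hi hi', ← he, ← he', sub_self]
  have hbd : ∀ y ∈ Metric.ball y₀ r, ‖(K x y - K' x y) - c‖ ≤ ‖c‖ / 2 := by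
    intro y hy
    have := hball (x, y) (by
      rw [Prod.dist_eq]
      exact max_lt hxr hy)
    rw [dist_eq_norm] at this
    exact this.le
  have hcontx : Continuous (fun y => K x y - K' x y) :=
    hcont.comp (by fun_prop : Continuous fun y : Rd d => ((x, y) : Rd d × Rd d))
  have hint : IntegrableOn (fun y => K x y - K' x y) (Metric.ball y₀ r) :=
    (hcontx.continuousOn.integrableOn_compact (isCompact_closedBall y₀ r)).mono_set
      Metric.ball_subset_closedBall
  have h1 := norm_setIntegral_le_of_norm_le_const (μ := volume) hfin.lt_top hbd
  rw [integral_sub hint (integrableOn_const hfin), hzero, zero_sub, norm_neg,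
    setIntegral_const, norm_smul] at h1
  have hv : 0 < volume.real (Metric.ball y₀ r) :=
    ENNReal.toReal_pos (Metric.measure_ball_pos _ _ hr).ne' hfin
  rw [Real.norm_of_nonneg hv.le] at h1
  nlinarith

open Classical in
/-- The continuous kernel `T(x, y)` of an operator `T` (by convention zero if there is none). -/
def kernel {d : ℕ} (T : L2 d →L[ℂ] L2 d) : Rd d → Rd d → ℂ :=
  if h : ∃ K, IsContinuousKernel T K then h.choose else 0

theorem IsContinuousKernel.kernel_eq {d : ℕ} {T : L2 d →L[ℂ] L2 d} {K : Rd d → Rd d → ℂ}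
    (hK : IsContinuousKernel T K) : kernel T = K := by
  have h : ∃ K, IsContinuousKernel T K := ⟨K, hK⟩
  rw [kernel, dif_pos h]
  exact h.choose_spec.unique hK

/-- The semiclassical Wigner transform of a kernel:
`(2πħ)⁻ᵈ ∫ K(x + v/2, x - v/2) e^{-(i/ħ) v·ξ} dv`. -/
def wignerTransform {d : ℕ} (ħ : ℝ) (K : Rd d → Rd d → ℂ) (x ξ : Rd d) : ℂ :=
  ((2 * Real.pi * ħ : ℝ) : ℂ)⁻¹ ^ d *
    ∫ v : Rd d, K (x + (1 / 2 : ℝ) • v) (x - (1 / 2 : ℝ) • v) *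
      Complex.exp (-(Complex.I / (ħ : ℂ)) * ((inner ℝ v ξ : ℝ) : ℂ))

/-- The eigenvalue `E_N(ħ) = ħ (N + d/2)`. -/
def energy (d : ℕ) (ħ : ℝ) (N : ℕ) : ℝ := ħ * ((N : ℝ) + (d : ℝ) / 2)

/-- The Wigner distribution `W_{ħ, E_N(ħ)}` of the eigenspace projection. -/
def wigner (d : ℕ) (ħ : ℝ) (N : ℕ) (x ξ : Rd d) : ℂ :=
  wignerTransform ħ (kernel (eigenProjection d ħ (energy d ħ N))) x ξ

/-- For `ħ > 0` only finitely many eigenvalues lie in a bounded energy window. -/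
theorem finite_window (d : ℕ) {ħ : ℝ} (hħ : 0 < ħ) (E₁ E₂ : ℝ) :
    {N : ℕ | energy d ħ N ∈ Set.Icc E₁ E₂}.Finite := by
  refine (Set.finite_Iic ⌊E₂ / ħ⌋₊).subset fun N hN => ?_
  have h : ħ * ((N : ℝ) + (d : ℝ) / 2) ≤ E₂ := hN.2
  refine Nat.le_floor ?_
  rw [le_div_iff₀ hħ]
  have : 0 ≤ ħ * ((d : ℝ) / 2) := by positivity
  nlinarith

/-- The bulk Wigner distribution `W_{ħ,[E₁,E₂]} = ∑_{N : E_N(ħ) ∈ [E₁,E₂]} W_{ħ,E_N(ħ)}`;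
the sum is finite for `ħ > 0` by `finite_window`. -/
def bulkWigner (d : ℕ) (ħ E₁ E₂ : ℝ) (x ξ : Rd d) : ℂ :=
  ∑ᶠ N ∈ {N : ℕ | energy d ħ N ∈ Set.Icc E₁ E₂}, wigner d ħ N x ξ

/-- The classical Hamiltonian `H(x, ξ) = (‖x‖² + ‖ξ‖²)/2`. -/
def hamiltonian {d : ℕ} (x ξ : Rd d) : ℝ := (‖x‖ ^ 2 + ‖ξ‖ ^ 2) / 2

end

end WignerOsc

/-! The eigenspace for `E_N(ħ)` is spanned by the products of Hermite functions of total degree `N`,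
and the Wigner function of the `n`-th normalized Hermite state in one variable is a constant
multiple of `e^{-s/2} (-1)ⁿ Lₙ(s)` with `s = 2(x² + ξ²)/ħ`. The Laguerre addition formula collapses
the sum over multi-indices, so that (`wigner_eq`) `(2πħ)ᵈ W_N = 2ᵈ e^{-s/2} (-1)ᴺ L_N^{(d-1)}(s)`
with `s = 4H/ħ`. The theorem thus concerns Laguerre functions near or away from their turning point
`s = ν = 4N + 2`, which is `E_N = H` up to `O(ħ)`.

Cumulative sums over `N ≤ m` are handled by the generating series (`pow_mul_genLagSum`): up to
finitely many boundary terms of degree `m`, lowering the index to zero turns `2ᵈ` times the sum into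
`S₀`, and `e^{-s/2} S₀ = 1 - ½ ∫₀ˢ u`, where `u` is `lagFun m`. If the cut lies above `H`, then `s`
is in the oscillatory region. Sonine's energy functional decreases there and gives `u = O(ν^{-1/2})`
and `s u' = O(ν^{1/2})`; integration by parts makes the integral `O(ν^{-1/2})`, so the cumulative
sum is `1 + O(ħ^{1/2})` (`exists_allowed_sum_bound`).

For energies below `H` the three-term recurrence forces geometric growth in the degree. As every
Laguerre function is bounded by 1, those of lower degree must be exponentially small
(`exists_forbidden_sum_bound`).

The window is a difference of two cumulative sums. In (i) the sum up to `E₂` is `1 + O(ħ^{1/2})` and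
the removed part is negligible; in (ii) both sums are `1 + O(ħ^{1/2})` and the ones cancel; in (iii)
every term is negligible. -/

namespace WignerOsc

noncomputable section

/-! ### Signed Laguerre polynomials: recurrence and differential equation. -/

/-- The pair `(q, o)` with `q = (-1)ⁿ Lₙ(s)` and `o = (n + 1) (qₙ₊₁ + qₙ)`. -/
def lagPair (s : ℝ) : ℕ → ℝ × ℝ
  | 0 => (1, s)
  | n + 1 => (((lagPair s n).2 / (n + 1) - (lagPair s n).1),
      s * ((lagPair s n).2 / (n + 1) - (lagPair s n).1) - (lagPair s n).2)

/-- The signed Laguerre polynomial `(-1)ⁿ Lₙ(s)`. -/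
def lag (n : ℕ) (s : ℝ) : ℝ := (lagPair s n).1

/-- The auxiliary sequence `(n + 1) (lag (n + 1) + lag n)`. -/
def lagSum (n : ℕ) (s : ℝ) : ℝ := (lagPair s n).2

/-- The derivative of `lag n`. -/
def lagDeriv : ℕ → ℝ → ℝ
  | 0, _ => 0
  | n + 1, s => lag n s - lagDeriv n s

@[simp] theorem lag_zero (s : ℝ) : lag 0 s = 1 := rfl

@[simp] theorem lagSum_zero (s : ℝ) : lagSum 0 s = s := rfl

theorem lag_succ (n : ℕ) (s : ℝ) : lag (n + 1) s = lagSum n s / (n + 1) - lag n s := rfl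

theorem lagSum_succ (n : ℕ) (s : ℝ) : lagSum (n + 1) s = s * lag (n + 1) s - lagSum n s := rfl

theorem lag_succ_add (n : ℕ) (s : ℝ) : (n + 1) * (lag (n + 1) s + lag n s) = lagSum n s := by
  have : (n : ℝ) + 1 ≠ 0 := by positivity
  rw [lag_succ]
  field_simp
  ring

theorem mul_lagDeriv (n : ℕ) (s : ℝ) : s * lagDeriv n s = s * lag n s - lagSum n s := by
  induction n with
  | zero => simp [lagDeriv]
  | succ n ih =>
    rw [lagSum_succ, lagDeriv, mul_sub, ih]
    ring

/-- The two derivatives need a joint induction, because each step of `lagPair` feeds one component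
into the other. -/
theorem hasDerivAt_lag_lagSum (n : ℕ) (s : ℝ) :
    HasDerivAt (lag n) (lagDeriv n s) s ∧ HasDerivAt (lagSum n) ((n + 1) * lag n s) s := by
  induction n with
  | zero =>
    refine ⟨hasDerivAt_const s 1, ?_⟩
    exact (hasDerivAt_id s).congr_deriv (by simp)
  | succ n ih =>
    have hn : (n : ℝ) + 1 ≠ 0 := by positivity
    have h1 : HasDerivAt (lag (n + 1)) (lagDeriv (n + 1) s) s := by
      have := (ih.2.div_const ((n : ℝ) + 1)).sub ih.1
      rw [mul_div_cancel_left₀ _ hn] at this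
      exact this
    refine ⟨h1, ?_⟩
    have h2 := ((hasDerivAt_id s).mul h1).sub ih.2
    refine h2.congr_deriv ?_
    have h3 := mul_lagDeriv (n + 1) s
    have h4 := lag_succ_add n s
    rw [lagSum_succ] at h3
    simp only [id]
    push_cast
    linear_combination h3 - h4

theorem hasDerivAt_lag (n : ℕ) (s : ℝ) : HasDerivAt (lag n) (lagDeriv n s) s :=
  (hasDerivAt_lag_lagSum n s).1

/-- Laguerre's equation in divergence form. -/
theorem hasDerivAt_mul_lagDeriv (n : ℕ) (s : ℝ) :
    HasDerivAt (fun s => s * lagDeriv n s) (s * lagDeriv n s - n * lag n s) s := by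
  have h : (fun s => s * lagDeriv n s) = fun s => s * lag n s - lagSum n s := by
    funext s
    exact mul_lagDeriv n s
  rw [h]
  refine (((hasDerivAt_id s).mul (hasDerivAt_lag n s)).sub
    (hasDerivAt_lag_lagSum n s).2).congr_deriv ?_
  simp only [id]
  ring

/-! ### Generating series, addition formula and partial sums. -/

section Series

open PowerSeries

/-- The formal power series `exp (s X / (1 + X))`. -/
def lagExp (s : ℝ) : PowerSeries ℝ := (1 + X) * PowerSeries.mk fun n => lag n s

/-- The formal power series `1 / (1 + X)`. -/
def altGeom : PowerSeries ℝ := PowerSeries.mk fun n => (-1) ^ n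

theorem one_add_X_mul_altGeom : (1 + X) * altGeom = 1 := by
  ext n
  cases n with
  | zero => simp [altGeom, add_mul]
  | succ n => simp [altGeom, add_mul, coeff_succ_X_mul, pow_succ, coeff_one]

theorem one_add_X_ne_zero : (1 + X : PowerSeries ℝ) ≠ 0 := by
  intro h
  have := congrArg constantCoeff h
  simp at this

theorem lagExp_ode (s : ℝ) : (1 + X) ^ 2 * d⁄dX ℝ (lagExp s) = C s * lagExp s := by
  have h1 : d⁄dX ℝ (lagExp s) = PowerSeries.mk fun n => lagSum n s := by
    ext n
    rw [coeff_derivative, lagExp, add_mul, one_mul, map_add, coeff_succ_X_mul]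
    simp only [coeff_mk]
    rw [← lag_succ_add]
    ring
  have h2 : (1 + X) * (PowerSeries.mk fun n => lagSum n s)
      = C s * PowerSeries.mk fun n => lag n s := by
    ext n
    cases n with
    | zero => simp [add_mul]
    | succ n =>
      rw [add_mul, one_mul, map_add, coeff_succ_X_mul, coeff_C_mul]
      simp only [coeff_mk]
      rw [lagSum_succ]
      ring
  rw [h1, pow_two, mul_assoc, h2, lagExp]
  ring

theorem constantCoeff_lagExp (s : ℝ) : constantCoeff (lagExp s) = 1 := by
  rw [lagExp, map_mul, map_add, map_one, constantCoeff_X, add_zero, one_mul,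
    ← coeff_zero_eq_constantCoeff_apply, coeff_mk, lag_zero]

/-- The logarithmic derivatives of the factors are opposite, so the product has derivative zero and
is fixed by its constant term. This yields uniqueness for the formal equation `(1 + X)² G' = a G`,
and hence the exponential law without composing power series. -/
theorem mul_lagExp_neg {a : ℝ} {G : PowerSeries ℝ} (h : (1 + X) ^ 2 * d⁄dX ℝ G = C a * G)
    (h1 : constantCoeff G = 1) : G * lagExp (-a) = 1 := by
  apply derivative.ext
  · have h2 := lagExp_ode (-a)
    rw [derivative_one]
    have h3 : (1 + X) ^ 2 * d⁄dX ℝ (G * lagExp (-a)) = 0 := by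
      rw [Derivation.leibniz, smul_eq_mul, smul_eq_mul]
      have h4 : C (-a) = - C a := map_neg _ _
      rw [h4] at h2
      linear_combination G * h2 + lagExp (-a) * h
    exact (mul_eq_zero.mp h3).resolve_left (pow_ne_zero 2 one_add_X_ne_zero)
  · rw [map_mul, h1, constantCoeff_lagExp]
    simp

theorem lagExp_unique {a : ℝ} {G : PowerSeries ℝ} (h : (1 + X) ^ 2 * d⁄dX ℝ G = C a * G)
    (h1 : constantCoeff G = 1) : G = lagExp a := by
  have h2 := mul_lagExp_neg h h1
  have h3 := mul_lagExp_neg (lagExp_ode a) (constantCoeff_lagExp a)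
  calc G = G * (lagExp a * lagExp (-a)) := by rw [h3, mul_one]
    _ = lagExp a * (G * lagExp (-a)) := by ring
    _ = lagExp a := by rw [h2, mul_one]

theorem lagExp_zero : lagExp 0 = 1 := by
  refine (lagExp_unique ?_ (map_one _)).symm
  simp

theorem lagExp_add (a b : ℝ) : lagExp (a + b) = lagExp a * lagExp b := by
  refine (lagExp_unique ?_ ?_).symm
  · rw [Derivation.leibniz, smul_eq_mul, smul_eq_mul, map_add]
    linear_combination lagExp b * lagExp_ode a + lagExp a * lagExp_ode b
  · rw [map_mul, constantCoeff_lagExp, constantCoeff_lagExp, mul_one]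

theorem lagExp_sum {ι : Type*} (S : Finset ι) (f : ι → ℝ) :
    lagExp (∑ i ∈ S, f i) = ∏ i ∈ S, lagExp (f i) := by
  classical
  induction S using Finset.induction_on with
  | empty => simp [lagExp_zero]
  | insert a S ha ih => rw [Finset.sum_insert ha, Finset.prod_insert ha, lagExp_add, ih]

/-- The generating series `(1 + X)⁻ᵏ exp (s X / (1 + X))` of signed Laguerre polynomials
of index `k - 1`. -/
def lagSeries (k : ℕ) (s : ℝ) : PowerSeries ℝ := lagExp s * altGeom ^ k

/-- The signed Laguerre polynomial `(-1)ⁿ Lₙ⁽ᵏ⁻¹⁾(s)`. -/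
def genLag (k n : ℕ) (s : ℝ) : ℝ := coeff n (lagSeries k s)

theorem lagSeries_eq_mul_succ (k : ℕ) (s : ℝ) :
    lagSeries k s = (1 + X) * lagSeries (k + 1) s := by
  rw [lagSeries, lagSeries, pow_succ]
  linear_combination (-lagExp s * altGeom ^ k) * one_add_X_mul_altGeom

theorem lagSeries_one (s : ℝ) : lagSeries 1 s = PowerSeries.mk fun n => lag n s := by
  rw [lagSeries, lagExp, pow_one]
  linear_combination (PowerSeries.mk fun n => lag n s) * one_add_X_mul_altGeom

theorem genLag_one (n : ℕ) (s : ℝ) : genLag 1 n s = lag n s := by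
  rw [genLag, lagSeries_one, coeff_mk]

/-- Addition formula: the exponentials multiply and each variable contributes one factor `altGeom`.
It is the reason why the Wigner distribution depends on the phase space point only through `H`. -/
theorem sum_prod_lag {d : ℕ} (N : ℕ) (s : Fin d → ℝ) :
    ∑ l ∈ Finset.finsuppAntidiag Finset.univ N, ∏ i, lag (l i) (s i) = genLag d N (∑ i, s i) := by
  have : lagSeries d (∑ i, s i) = ∏ i, lagSeries 1 (s i) := by
    simp only [lagSeries, lagExp_sum, Finset.prod_mul_distrib, pow_one, Finset.prod_const,
      Finset.card_univ, Fintype.card_fin]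
  rw [genLag, this, coeff_prod]
  simp only [lagSeries_one, coeff_mk]

theorem genLag_zero_right (k : ℕ) (s : ℝ) : genLag k 0 s = 1 := by
  rw [genLag, coeff_zero_eq_constantCoeff_apply, lagSeries, map_mul, map_pow, constantCoeff_lagExp]
  rw [altGeom, ← coeff_zero_eq_constantCoeff_apply, coeff_mk]
  simp

theorem genLag_eq_add (k n : ℕ) (s : ℝ) :
    genLag k (n + 1) s = genLag (k + 1) (n + 1) s + genLag (k + 1) n s := by
  rw [genLag, lagSeries_eq_mul_succ, add_mul, one_mul, map_add, coeff_succ_X_mul]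
  rfl

/-- Coefficient form of `X · d/dX` applied to `lagSeries k`, simplified by the differential equation
of `lagExp`. The degree stays fixed while the index rises, so estimates for indices 0 and 1 reach
all indices. -/
theorem genLag_recurrence (k n : ℕ) (s : ℝ) :
    s * genLag (k + 2) n s = (s + k) * genLag (k + 1) n s - (n + k) * genLag k n s := by
  have hode : d⁄dX ℝ (lagSeries k s) = C s * lagSeries (k + 2) s - C (k : ℝ) * lagSeries (k + 1) s := by
    have hA : (1 + X) * d⁄dX ℝ altGeom = - altGeom := by
      have := congrArg (d⁄dX ℝ) one_add_X_mul_altGeom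
      rw [Derivation.leibniz, derivative_one, map_add, derivative_one, derivative_X,
        smul_eq_mul, smul_eq_mul] at this
      linear_combination this
    have hk : (1 + X) * d⁄dX ℝ (altGeom ^ k) = - (C (k : ℝ) * altGeom ^ k) := by
      have hc : C (k : ℝ) = (k : PowerSeries ℝ) := map_natCast _ _
      rw [derivative_pow, hc]
      cases k with
      | zero => simp
      | succ k =>
        rw [Nat.add_sub_cancel, pow_succ]
        linear_combination (((k + 1 : ℕ) : PowerSeries ℝ) * altGeom ^ k) * hA
    have h := lagExp_ode s
    have h1 : (1 + X) ^ 2 * d⁄dX ℝ (lagSeries k s)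
        = C s * lagSeries k s - C (k : ℝ) * (1 + X) * lagSeries k s := by
      rw [lagSeries, Derivation.leibniz, smul_eq_mul, smul_eq_mul]
      linear_combination (altGeom ^ k) * h + (1 + X) * lagExp s * hk
    refine mul_left_cancel₀ (pow_ne_zero 2 one_add_X_ne_zero) ?_
    rw [h1]
    rw [lagSeries_eq_mul_succ k, lagSeries_eq_mul_succ (k + 1)]
    ring
  have h2 : X * d⁄dX ℝ (lagSeries k s) = C s * (lagSeries (k + 1) s - lagSeries (k + 2) s)
      - C (k : ℝ) * (lagSeries k s - lagSeries (k + 1) s) := by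
    rw [hode]
    linear_combination (- C s) * lagSeries_eq_mul_succ (k + 1) s
      + C (k : ℝ) * lagSeries_eq_mul_succ k s
  have h3 := congrArg (coeff n) h2
  have h4 : coeff n (X * d⁄dX ℝ (lagSeries k s)) = n * coeff n (lagSeries k s) := by
    cases n with
    | zero => simp
    | succ n =>
      rw [coeff_succ_X_mul, coeff_derivative]
      push_cast
      ring
  rw [h4] at h3
  simp only [map_sub, coeff_C_mul] at h3
  simp only [genLag]
  linear_combination h3

theorem genLag_zero_left (n : ℕ) (s : ℝ) : n * genLag 0 n s = s * lagDeriv n s := by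
  cases n with
  | zero => simp [lagDeriv]
  | succ n =>
    rw [genLag_eq_add, genLag_one, genLag_one, mul_lagDeriv, lagSum_succ]
    push_cast
    rw [lag_succ_add]
    ring

/-- Partial sums of the generating series at `1`. -/
def genLagSum (k m : ℕ) (s : ℝ) : ℝ := ∑ n ∈ Finset.range m, genLag k n s

/-- Summing `genLag_eq_add` over the degree counts every term twice except the last; the factor 2 is
`1 + X` at `X = 1`. -/
theorem genLagSum_succ (k m : ℕ) (s : ℝ) :
    2 * genLagSum (k + 1) (m + 1) s = genLagSum k (m + 1) s + genLag (k + 1) m s := by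
  induction m with
  | zero => simp [genLagSum, genLag_zero_right]; norm_num
  | succ m ih =>
    have h := genLag_eq_add k m s
    rw [genLagSum, Finset.sum_range_succ, ← genLagSum, mul_add, ih, genLagSum,
      genLagSum, Finset.sum_range_succ _ (m + 1), h]
    ring

theorem pow_mul_genLagSum (d m : ℕ) (s : ℝ) :
    2 ^ d * genLagSum d (m + 1) s = genLagSum 0 (m + 1) s
      + ∑ k ∈ Finset.range d, 2 ^ k * genLag (k + 1) m s := by
  induction d with
  | zero => simp
  | succ d ih =>
    rw [Finset.sum_range_succ, ← add_assoc, ← ih, pow_succ, mul_assoc, genLagSum_succ]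
    ring

theorem genLag_zero_left_zero (n : ℕ) : genLag 0 n 0 = if n = 0 then 1 else 0 := by
  rw [genLag, lagSeries, lagExp_zero, pow_zero, mul_one, coeff_one]

theorem genLagSum_zero_left_zero (m : ℕ) : genLagSum 0 (m + 1) 0 = 1 := by
  simp [genLagSum, genLag_zero_left_zero]

/-- Multiplied by `exp (-s/2)`, the sum has derivative `-½ lagFun m`: the whole cumulative sum is
governed by one Laguerre function. -/
theorem hasDerivAt_genLagSum_zero (m : ℕ) (s : ℝ) :
    HasDerivAt (genLagSum 0 (m + 1)) ((genLagSum 0 (m + 1) s - lag m s) / 2) s := by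
  induction m with
  | zero =>
    have : genLagSum 0 1 = fun _ => (1 : ℝ) := by
      funext s
      simp [genLagSum, genLag_zero_right]
    rw [this]
    simpa using hasDerivAt_const s (1 : ℝ)
  | succ m ih =>
    have h : genLagSum 0 (m + 1 + 1)
        = fun s => genLagSum 0 (m + 1) s + (lag (m + 1) s + lag m s) := by
      funext s
      rw [genLagSum, Finset.sum_range_succ, ← genLagSum, genLag_eq_add, genLag_one, genLag_one]
    rw [h]
    refine (ih.add ((hasDerivAt_lag (m + 1) s).add (hasDerivAt_lag m s))).congr_deriv ?_
    rw [lagDeriv]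
    ring

end Series

end

end WignerOsc
-- Gaussians as Schwartz functions.
namespace WignerOsc

noncomputable section

section Gaussian

open scoped ContDiff Nat

/-- Absorbs the polynomial factors that arise from differentiating a Gaussian. It is `yᵐ / m! ≤ eʸ`
at `y = a (1 + t²)`; the shift by 1 costs `eᵃ`. -/
theorem one_add_pow_mul_exp_le {a : ℝ} (ha : 0 < a) (m : ℕ) {t : ℝ} (ht : 0 ≤ t) :
    (1 + t) ^ m * Real.exp (-a * t ^ 2) ≤ 2 ^ m * (m ! * (a⁻¹) ^ m * Real.exp a) := by
  have h1 : (1 + t) ^ m ≤ (2 * (1 + t ^ 2)) ^ m := by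
    gcongr
    nlinarith [sq_nonneg (t - 1)]
  have h2 : (a * (1 + t ^ 2)) ^ m / m ! ≤ Real.exp (a * (1 + t ^ 2)) :=
    Real.pow_div_factorial_le_exp _ (by positivity) m
  rw [div_le_iff₀ (by positivity)] at h2
  have h3 : (1 + t ^ 2) ^ m = (a⁻¹) ^ m * (a * (1 + t ^ 2)) ^ m := by
    rw [← mul_pow, inv_mul_cancel_left₀ ha.ne']
  have h4 : Real.exp (a * (1 + t ^ 2)) * Real.exp (-a * t ^ 2) = Real.exp a := by
    rw [← Real.exp_add]
    ring_nf
  calc (1 + t) ^ m * Real.exp (-a * t ^ 2)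
      ≤ (2 * (1 + t ^ 2)) ^ m * Real.exp (-a * t ^ 2) := by gcongr
    _ = 2 ^ m * ((a⁻¹) ^ m * (a * (1 + t ^ 2)) ^ m) * Real.exp (-a * t ^ 2) := by
        rw [mul_pow, h3]
    _ ≤ 2 ^ m * ((a⁻¹) ^ m * (Real.exp (a * (1 + t ^ 2)) * m !)) * Real.exp (-a * t ^ 2) := by
        gcongr
    _ = 2 ^ m * (m ! * (a⁻¹) ^ m *
          (Real.exp (a * (1 + t ^ 2)) * Real.exp (-a * t ^ 2))) := by ring
    _ = _ := by rw [h4]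

variable {V : Type*} [NormedAddCommGroup V] [InnerProductSpace ℝ V]

/-- The Gaussian `exp (-a ‖x‖²)` as a Schwartz function. -/
def gaussian (V : Type*) [NormedAddCommGroup V] [InnerProductSpace ℝ V] {a : ℝ} (ha : 0 < a) :
    𝓢(V, ℝ) where
  toFun x := Real.exp (-a * ‖x‖ ^ 2)
  smooth' := by
    have h : ContDiff ℝ ∞ fun x : V => ‖x‖ ^ 2 := contDiff_norm_sq ℝ
    exact Real.contDiff_exp.comp (contDiff_const.mul h)
  decay' k n := by
    have hf : (fun x : V => -a * ‖x‖ ^ 2).HasTemperateGrowth :=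
      (Function.HasTemperateGrowth.const (-a)).mul (Function.hasTemperateGrowth_norm_sq (H := V))
    obtain ⟨k₀, C, hC, hb⟩ := hf.norm_iteratedFDeriv_le_uniform n
    refine ⟨n ! * (C + 1) ^ n * (2 ^ (k + k₀ * n) * ((k + k₀ * n) ! * (a⁻¹) ^ (k + k₀ * n) *
      Real.exp a)), fun x => ?_⟩
    have h1 : ‖iteratedFDeriv ℝ n (Real.exp ∘ fun x : V => -a * ‖x‖ ^ 2) x‖
        ≤ n ! * Real.exp (-a * ‖x‖ ^ 2) * ((C + 1) * (1 + ‖x‖) ^ k₀) ^ n := by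
      refine norm_iteratedFDeriv_comp_le (N := ∞) Real.contDiff_exp hf.1 (by exact_mod_cast le_top) x
        (fun i _ => ?_) (fun i hi hin => ?_)
      · rw [norm_iteratedFDeriv_eq_norm_iteratedDeriv, iteratedDeriv_eq_iterate,
          Real.iter_deriv_exp, Real.norm_of_nonneg (Real.exp_pos _).le]
      · refine (hb i hin x).trans ?_
        have h2 : 1 ≤ (C + 1) * (1 + ‖x‖) ^ k₀ := by
          have : 1 ≤ (1 + ‖x‖) ^ k₀ := one_le_pow₀ (by linarith [norm_nonneg x])
          nlinarith
        refine le_trans ?_ (le_self_pow₀ h2 (by omega))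
        gcongr
        linarith
    have h3 := one_add_pow_mul_exp_le ha (k + k₀ * n) (norm_nonneg x)
    have h4 : ‖x‖ ^ k ≤ (1 + ‖x‖) ^ k := by
      gcongr
      linarith
    calc ‖x‖ ^ k * ‖iteratedFDeriv ℝ n (fun x : V => Real.exp (-a * ‖x‖ ^ 2)) x‖
        ≤ (1 + ‖x‖) ^ k *
          (n ! * Real.exp (-a * ‖x‖ ^ 2) * ((C + 1) * (1 + ‖x‖) ^ k₀) ^ n) := by
          gcongr
          exact h1
      _ = n ! * (C + 1) ^ n * ((1 + ‖x‖) ^ (k + k₀ * n) * Real.exp (-a * ‖x‖ ^ 2)) := by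
          rw [mul_pow, pow_add, pow_mul]
          ring
      _ ≤ _ := by gcongr

theorem gaussian_apply {a : ℝ} (ha : 0 < a) (x : V) :
    gaussian V ha x = Real.exp (-a * ‖x‖ ^ 2) := rfl

theorem hasTemperateGrowth_polynomial_eval {f : V → ℝ} (hf : f.HasTemperateGrowth)
    (p : Polynomial ℝ) : (fun x => p.eval (f x)).HasTemperateGrowth := by
  induction p using Polynomial.induction_on' with
  | add p q hp hq =>
    simp only [Polynomial.eval_add]
    exact hp.add hq
  | monomial n a =>
    simp only [Polynomial.eval_monomial]
    exact (Function.HasTemperateGrowth.const a).mul (hf.pow n)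

theorem hasTemperateGrowth_prod {ι : Type*} (S : Finset ι) {f : ι → V → ℝ}
    (hf : ∀ i, (f i).HasTemperateGrowth) : (fun x => ∏ i ∈ S, f i x).HasTemperateGrowth := by
  classical
  induction S using Finset.induction_on with
  | empty => simp
  | insert a S ha ih =>
    simp only [Finset.prod_insert ha]
    exact (hf a).mul ih

end Gaussian

/-! ### Hermite functions in one variable. -/

section Hermite

/-- Hermite polynomials adapted to the parameter `ħ`. -/
def hermPoly (ħ : ℝ) : ℕ → Polynomial ℝ
  | 0 => 1
  | n + 1 => Polynomial.C 2 * Polynomial.X * hermPoly ħ n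
      - Polynomial.C ħ * Polynomial.derivative (hermPoly ħ n)

/-- The lowering relation. For `n = 0` the truncated index `n - 1` is harmless because its
coefficient vanishes; later recurrences rely on the same convention. -/
theorem derivative_hermPoly (ħ : ℝ) (n : ℕ) :
    Polynomial.derivative (hermPoly ħ n) = Polynomial.C (2 * n : ℝ) * hermPoly ħ (n - 1) := by
  induction n with
  | zero => simp [hermPoly]
  | succ n ih =>
    have h : Polynomial.C (2 * n : ℝ) * hermPoly ħ n = Polynomial.C (2 * n : ℝ) *
        (Polynomial.C 2 * Polynomial.X * hermPoly ħ (n - 1)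
          - Polynomial.C ħ * Polynomial.derivative (hermPoly ħ (n - 1))) := by
      cases n with
      | zero => simp
      | succ n => rw [Nat.add_sub_cancel, ← hermPoly]
    rw [hermPoly, Polynomial.derivative_sub, Polynomial.derivative_mul, Polynomial.derivative_mul,
      Polynomial.derivative_mul, ih, Polynomial.derivative_mul]
    simp only [Polynomial.derivative_C, Polynomial.derivative_X, Nat.add_sub_cancel]
    push_cast
    simp only [map_mul, map_add, map_one] at h ⊢
    linear_combination -h

/-- The Hermite functions (unnormalized), `hermFun ħ (n + 1) = (x - ħ ∂) (hermFun ħ n)`. -/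
def hermFun (ħ : ℝ) (n : ℕ) (x : ℝ) : ℝ :=
  (hermPoly ħ n).eval x * Real.exp (-(1 / (2 * ħ)) * x ^ 2)

variable {ħ : ℝ}

theorem hermFun_succ (n : ℕ) (x : ℝ) :
    hermFun ħ (n + 1) x = 2 * x * hermFun ħ n x - 2 * n * ħ * hermFun ħ (n - 1) x := by
  simp only [hermFun]
  rw [hermPoly, derivative_hermPoly]
  simp only [Polynomial.eval_sub, Polynomial.eval_mul, Polynomial.eval_C, Polynomial.eval_X]
  ring

theorem hasDerivAt_hermFun (hħ : 0 < ħ) (n : ℕ) (x : ℝ) :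
    HasDerivAt (hermFun ħ n) ((x * hermFun ħ n x - hermFun ħ (n + 1) x) / ħ) x := by
  have h1 := (hermPoly ħ n).hasDerivAt x
  have h2 : HasDerivAt (fun x : ℝ => Real.exp (-(1 / (2 * ħ)) * x ^ 2))
      (Real.exp (-(1 / (2 * ħ)) * x ^ 2) * (-(1 / (2 * ħ)) * (2 * x))) x := by
    have := ((hasDerivAt_pow 2 x).const_mul (-(1 / (2 * ħ)))).exp
    simpa using this
  refine (h1.mul h2).congr_deriv ?_
  simp only [hermFun, hermPoly, Polynomial.eval_sub, Polynomial.eval_mul, Polynomial.eval_C,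
    Polynomial.eval_X]
  field_simp
  ring

theorem hasDerivAt_hermFun' (hħ : 0 < ħ) (n : ℕ) (x : ℝ) :
    HasDerivAt (hermFun ħ n) ((-x * hermFun ħ n x + 2 * n * ħ * hermFun ħ (n - 1) x) / ħ) x := by
  refine (hasDerivAt_hermFun hħ n x).congr_deriv ?_
  rw [hermFun_succ]
  ring

theorem mul_hermFun (n : ℕ) (x : ℝ) :
    x * hermFun ħ n x = (1 / 2) * hermFun ħ (n + 1) x + n * ħ * hermFun ħ (n - 1) x := by
  rw [hermFun_succ]
  ring

/-- The Hermite functions as Schwartz functions. -/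
def hermSchwartz (hħ : 0 < ħ) (n : ℕ) : 𝓢(ℝ, ℝ) :=
  SchwartzMap.smulLeftCLM ℝ (fun x => (hermPoly ħ n).eval x)
    (gaussian ℝ (show 0 < 1 / (2 * ħ) by positivity))

theorem hermSchwartz_apply (hħ : 0 < ħ) (n : ℕ) (x : ℝ) :
    hermSchwartz hħ n x = hermFun ħ n x := by
  rw [hermSchwartz, SchwartzMap.smulLeftCLM_apply_apply
    (hasTemperateGrowth_polynomial_eval Function.HasTemperateGrowth.id' _), gaussian_apply,
    smul_eq_mul, Real.norm_eq_abs, sq_abs, hermFun]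

theorem continuous_hermFun (n : ℕ) : Continuous (hermFun ħ n) := by
  unfold hermFun
  fun_prop

theorem integrable_hermFun (hħ : 0 < ħ) (n : ℕ) : Integrable (hermFun ħ n) := by
  have h : hermFun ħ n = hermSchwartz hħ n := funext fun x => (hermSchwartz_apply hħ n x).symm
  rw [h]
  exact (hermSchwartz hħ n).integrable

theorem exists_abs_hermFun_le (hħ : 0 < ħ) (n : ℕ) : ∃ C, ∀ x, |hermFun ħ n x| ≤ C := by
  refine ⟨SchwartzMap.seminorm ℝ 0 0 (hermSchwartz hħ n), fun x => ?_⟩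
  rw [← hermSchwartz_apply hħ, ← Real.norm_eq_abs]
  exact SchwartzMap.norm_le_seminorm ℝ _ x

theorem integrable_hermFun_mul (hħ : 0 < ħ) (m n : ℕ) :
    Integrable fun x => hermFun ħ m x * hermFun ħ n x := by
  obtain ⟨C, hC⟩ := exists_abs_hermFun_le hħ n
  exact (integrable_hermFun hħ m).mul_bdd (continuous_hermFun n).aestronglyMeasurable
    (Eventually.of_forall hC)

/-- Raising on one factor is adjoint to lowering on the other: integrate the derivative of the
product. -/
theorem integral_hermFun_succ_mul (hħ : 0 < ħ) (m n : ℕ) :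
    ∫ x, hermFun ħ (m + 1) x * hermFun ħ n x
      = 2 * n * ħ * ∫ x, hermFun ħ m x * hermFun ħ (n - 1) x := by
  have h := integral_eq_zero_of_hasDerivAt_of_integrable
    (f := fun x => ħ * (hermFun ħ m x * hermFun ħ n x))
    (f' := fun x => 2 * n * ħ * (hermFun ħ m x * hermFun ħ (n - 1) x)
      - hermFun ħ (m + 1) x * hermFun ħ n x)
    (fun x => by
      refine (((hasDerivAt_hermFun hħ m x).mul (hasDerivAt_hermFun' hħ n x)).const_mul
        ħ).congr_deriv ?_
      field_simp
      ring)
    (((integrable_hermFun_mul hħ _ _).const_mul _).sub (integrable_hermFun_mul hħ _ _))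
    ((integrable_hermFun_mul hħ _ _).const_mul _)
  rw [integral_sub ((integrable_hermFun_mul hħ _ _).const_mul _) (integrable_hermFun_mul hħ _ _),
    integral_const_mul] at h
  linarith

/-- The squared norm of `hermFun ħ n`. -/
def hermNormSq (ħ : ℝ) (n : ℕ) : ℝ := (2 * ħ) ^ n * (n.factorial : ℝ) * Real.sqrt (Real.pi * ħ)

theorem hermNormSq_pos (hħ : 0 < ħ) (n : ℕ) : 0 < hermNormSq ħ n := by
  have := Real.pi_pos
  unfold hermNormSq
  positivity

theorem integral_hermFun_mul (hħ : 0 < ħ) (m n : ℕ) :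
    ∫ x, hermFun ħ m x * hermFun ħ n x = if m = n then hermNormSq ħ n else 0 := by
  induction m generalizing n with
  | zero =>
    cases n with
    | zero =>
      have h : (fun x => hermFun ħ 0 x * hermFun ħ 0 x) = fun x => Real.exp (-(1 / ħ) * x ^ 2) := by
        funext x
        simp only [hermFun, hermPoly, Polynomial.eval_one, one_mul]
        rw [← Real.exp_add]
        congr 1
        field_simp
        ring
      rw [h, integral_gaussian]
      simp [hermNormSq]
    | succ n =>
      have h := integral_hermFun_succ_mul hħ n 0
      simp only [CharP.cast_eq_zero, mul_zero, zero_mul] at h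
      simp only [mul_comm (hermFun ħ 0 _)]
      rw [h, if_neg (by omega)]
  | succ m ih =>
    rw [integral_hermFun_succ_mul hħ, ih]
    cases n with
    | zero => simp
    | succ n =>
      by_cases hmn : m = n
      · simp only [hmn, Nat.add_sub_cancel, if_true, hermNormSq, pow_succ, Nat.factorial_succ]
        push_cast
        ring
      · simp [hmn]

end Hermite

end

end WignerOsc
-- Cross-Wigner functions of Hermite functions.
namespace WignerOsc

noncomputable section

open Complex (I)

variable {ħ : ℝ}

/-- The integrand of the cross-Wigner function of two Hermite functions. -/
def hermCross (ħ : ℝ) (m n : ℕ) (x ξ v : ℝ) : ℂ :=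
  ((hermFun ħ m (x + 1 / 2 * v) * hermFun ħ n (x - 1 / 2 * v) : ℝ) : ℂ) *
    Complex.exp (-(I / (ħ : ℂ)) * ((v * ξ : ℝ) : ℂ))

/-- The cross-Wigner function of two Hermite functions (unnormalized). -/
def hermWigner (ħ : ℝ) (m n : ℕ) (x ξ : ℝ) : ℂ := ∫ v : ℝ, hermCross ħ m n x ξ v

theorem norm_exp_phase (ħ t : ℝ) : ‖Complex.exp (-(I / (ħ : ℂ)) * (t : ℂ))‖ = 1 := by
  have : -(I / (ħ : ℂ)) * (t : ℂ) = ((-(t / ħ) : ℝ) : ℂ) * I := by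
    push_cast
    ring
  rw [this, Complex.norm_exp_ofReal_mul_I]

theorem norm_hermCross (m n : ℕ) (x ξ v : ℝ) :
    ‖hermCross ħ m n x ξ v‖ = |hermFun ħ m (x + 1 / 2 * v) * hermFun ħ n (x - 1 / 2 * v)| := by
  rw [hermCross, norm_mul, norm_exp_phase, mul_one, Complex.norm_real, Real.norm_eq_abs]

theorem integrable_comp_add_half {f : ℝ → ℝ} (hf : Integrable f) (x : ℝ) :
    Integrable fun v => f (x + 1 / 2 * v) :=
  (hf.comp_add_left x).comp_mul_left' (by norm_num : (1 / 2 : ℝ) ≠ 0)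

theorem integrable_comp_sub_half {f : ℝ → ℝ} (hf : Integrable f) (x : ℝ) :
    Integrable fun v => f (x - 1 / 2 * v) :=
  (hf.comp_sub_left x).comp_mul_left' (by norm_num : (1 / 2 : ℝ) ≠ 0)

theorem continuous_hermCross (m n : ℕ) (x ξ : ℝ) : Continuous (hermCross ħ m n x ξ) := by
  have h1 := continuous_hermFun (ħ := ħ) m
  have h2 := continuous_hermFun (ħ := ħ) n
  unfold hermCross
  fun_prop

theorem integrable_hermCross (hħ : 0 < ħ) (m n : ℕ) (x ξ : ℝ) :
    Integrable (hermCross ħ m n x ξ) := by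
  obtain ⟨C, hC⟩ := exists_abs_hermFun_le hħ n
  have h := (integrable_comp_add_half (integrable_hermFun hħ m) x).norm.mul_const C
  refine h.mono' (continuous_hermCross m n x ξ).aestronglyMeasurable
    (Eventually.of_forall fun v => ?_)
  rw [norm_hermCross, abs_mul, Real.norm_eq_abs]
  exact mul_le_mul_of_nonneg_left (hC _) (abs_nonneg _)

theorem hasDerivAt_phase (ξ v : ℝ) :
    HasDerivAt (fun v : ℝ => Complex.exp (-(I / (ħ : ℂ)) * ((v * ξ : ℝ) : ℂ)))
      (Complex.exp (-(I / (ħ : ℂ)) * ((v * ξ : ℝ) : ℂ)) * (-(I / (ħ : ℂ)) * ξ)) v := by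
  have h : HasDerivAt (fun v : ℝ => ((v * ξ : ℝ) : ℂ)) (ξ : ℂ) v := by
    have := ((hasDerivAt_id v).mul_const ξ).ofReal_comp
    simpa using this
  exact (h.const_mul _).cexp

theorem hasDerivAt_comp_add_half {f : ℝ → ℝ} {f' x v : ℝ} (hf : HasDerivAt f f' (x + 1 / 2 * v)) :
    HasDerivAt (fun v => f (x + 1 / 2 * v)) (f' * (1 / 2)) v := by
  have h : HasDerivAt (fun v : ℝ => x + 1 / 2 * v) (1 / 2) v := by
    simpa using ((hasDerivAt_id v).const_mul (1 / 2 : ℝ)).const_add x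
  exact HasDerivAt.comp v hf h

theorem hasDerivAt_comp_sub_half {f : ℝ → ℝ} {f' x v : ℝ} (hf : HasDerivAt f f' (x - 1 / 2 * v)) :
    HasDerivAt (fun v => f (x - 1 / 2 * v)) (f' * (-(1 / 2))) v := by
  have h : HasDerivAt (fun v : ℝ => x - 1 / 2 * v) (-(1 / 2)) v := by
    simpa using ((hasDerivAt_id v).const_mul (1 / 2 : ℝ)).const_sub x
  exact HasDerivAt.comp v hf h

/-- The integral of the `v`-derivative of the integrand vanishes. Differentiation raises the left
factor, lowers the right one and brings down `ξ` from the phase; the two position terms add to `2x`.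
-/
theorem hermWigner_succ_left (hħ : 0 < ħ) (m n : ℕ) (x ξ : ℝ) :
    hermWigner ħ (m + 1) n x ξ = 2 * (x - I * ξ) * hermWigner ħ m n x ξ
      - 2 * n * ħ * hermWigner ħ m (n - 1) x ξ := by
  have hI := fun m n => integrable_hermCross hħ m n x ξ
  have hc : (ħ : ℂ) ≠ 0 := by exact_mod_cast hħ.ne'
  have h := integral_eq_zero_of_hasDerivAt_of_integrable
    (f := fun v => 2 * ħ * hermCross ħ m n x ξ v)
    (f' := fun v => 2 * (x - I * ξ) * hermCross ħ m n x ξ v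
      - 2 * n * ħ * hermCross ħ m (n - 1) x ξ v - hermCross ħ (m + 1) n x ξ v)
    (fun v => by
      have h1 := (hasDerivAt_comp_add_half (hasDerivAt_hermFun hħ m (x + 1 / 2 * v))).mul
        (hasDerivAt_comp_sub_half (hasDerivAt_hermFun' hħ n (x - 1 / 2 * v)))
      refine ((h1.ofReal_comp.mul (hasDerivAt_phase (ħ := ħ) ξ v)).const_mul
        (2 * ħ : ℂ)).congr_deriv ?_
      simp only [hermCross, Pi.mul_apply]
      push_cast
      field_simp
      ring)
    ((((hI _ _).const_mul _).sub ((hI _ _).const_mul _)).sub (hI _ _))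
    ((hI _ _).const_mul _)
  have hs : Integrable fun v => 2 * (x - I * ξ) * hermCross ħ m n x ξ v
      - 2 * n * ħ * hermCross ħ m (n - 1) x ξ v := ((hI _ _).const_mul _).sub ((hI _ _).const_mul _)
  rw [integral_sub hs (hI _ _), integral_sub ((hI _ _).const_mul _) ((hI _ _).const_mul _), integral_const_mul,
    integral_const_mul] at h
  exact (sub_eq_zero.mp h).symm

theorem hermWigner_succ_right (hħ : 0 < ħ) (m n : ℕ) (x ξ : ℝ) :
    hermWigner ħ m (n + 1) x ξ = 2 * (x + I * ξ) * hermWigner ħ m n x ξ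
      - 2 * m * ħ * hermWigner ħ (m - 1) n x ξ := by
  have hI := fun m n => integrable_hermCross hħ m n x ξ
  have hc : (ħ : ℂ) ≠ 0 := by exact_mod_cast hħ.ne'
  have h := integral_eq_zero_of_hasDerivAt_of_integrable
    (f := fun v => -2 * ħ * hermCross ħ m n x ξ v)
    (f' := fun v => 2 * (x + I * ξ) * hermCross ħ m n x ξ v
      - 2 * m * ħ * hermCross ħ (m - 1) n x ξ v - hermCross ħ m (n + 1) x ξ v)
    (fun v => by
      have h1 := (hasDerivAt_comp_add_half (hasDerivAt_hermFun' hħ m (x + 1 / 2 * v))).mul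
        (hasDerivAt_comp_sub_half (hasDerivAt_hermFun hħ n (x - 1 / 2 * v)))
      refine ((h1.ofReal_comp.mul (hasDerivAt_phase (ħ := ħ) ξ v)).const_mul
        (-2 * ħ : ℂ)).congr_deriv ?_
      simp only [hermCross, Pi.mul_apply]
      push_cast
      field_simp
      ring)
    ((((hI _ _).const_mul _).sub ((hI _ _).const_mul _)).sub (hI _ _))
    ((hI _ _).const_mul _)
  have hs : Integrable fun v => 2 * (x + I * ξ) * hermCross ħ m n x ξ v
      - 2 * m * ħ * hermCross ħ (m - 1) n x ξ v := ((hI _ _).const_mul _).sub ((hI _ _).const_mul _)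
  rw [integral_sub hs (hI _ _), integral_sub ((hI _ _).const_mul _) ((hI _ _).const_mul _), integral_const_mul,
    integral_const_mul] at h
  exact (sub_eq_zero.mp h).symm

theorem hermWigner_zero_zero (hħ : 0 < ħ) (x ξ : ℝ) :
    hermWigner ħ 0 0 x ξ
      = ((2 * Real.sqrt (Real.pi * ħ) * Real.exp (-((x ^ 2 + ξ ^ 2) / ħ)) : ℝ) : ℂ) := by
  have hc : (ħ : ℂ) ≠ 0 := by exact_mod_cast hħ.ne'
  have h : hermWigner ħ 0 0 x ξ = ∫ v : ℝ, Complex.exp (((-(1 / (4 * ħ)) : ℝ) : ℂ) * v ^ 2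
      + (-(I / ħ) * ξ) * v + ((-(x ^ 2 / ħ) : ℝ) : ℂ)) := by
    refine integral_congr_ae (Eventually.of_forall fun v => ?_)
    simp only [hermCross, hermFun, hermPoly, Polynomial.eval_one, one_mul]
    rw [← Real.exp_add, Complex.ofReal_exp, ← Complex.exp_add]
    congr 1
    push_cast
    field_simp
    ring
  have hre : (((-(1 / (4 * ħ)) : ℝ) : ℂ)).re < 0 := by
    rw [Complex.ofReal_re, neg_lt_zero]
    positivity
  rw [h, integral_cexp_quadratic hre]
  have h1 : ((Real.pi : ℂ) / -((-(1 / (4 * ħ)) : ℝ) : ℂ)) = ((4 * (Real.pi * ħ) : ℝ) : ℂ) := by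
    push_cast
    field_simp
  have h2 : (4 * (Real.pi * ħ)) ^ (1 / 2 : ℝ) = 2 * Real.sqrt (Real.pi * ħ) := by
    rw [← Real.sqrt_eq_rpow, show (4 : ℝ) * (Real.pi * ħ) = 2 ^ 2 * (Real.pi * ħ) by ring,
      Real.sqrt_mul (by norm_num), Real.sqrt_sq (by norm_num)]
  have h3 : ((4 * (Real.pi * ħ) : ℝ) : ℂ) ^ (1 / 2 : ℂ)
      = ((2 * Real.sqrt (Real.pi * ħ) : ℝ) : ℂ) := by
    have hp : 0 ≤ 4 * (Real.pi * ħ) := by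
      have := Real.pi_pos
      positivity
    rw [← h2, Complex.ofReal_cpow hp]
    norm_num
  rw [h1, h3, Complex.ofReal_mul _ (Real.exp _), Complex.ofReal_exp]
  congr 2
  push_cast
  field_simp
  linear_combination (ξ : ℂ) ^ 2 * Complex.I_sq

/-- The diagonal entries alone do not close under the raising relations. Together with the entries
`(n + 1, n)`, multiplied by `x + iξ`, they obey exactly the recursion of `lagPair`. -/
theorem hermWigner_diag (hħ : 0 < ħ) (n : ℕ) (x ξ : ℝ) :
    hermWigner ħ n n x ξ = hermWigner ħ 0 0 x ξ *
        ((2 * ħ) ^ n * n.factorial * lag n (2 * (x ^ 2 + ξ ^ 2) / ħ) : ℝ) ∧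
      (x + I * ξ) * hermWigner ħ (n + 1) n x ξ = hermWigner ħ 0 0 x ξ *
        ((2 * ħ) ^ n * n.factorial * ħ * lagSum n (2 * (x ^ 2 + ξ ^ 2) / ħ) : ℝ) := by
  have hc : (ħ : ℂ) ≠ 0 := by exact_mod_cast hħ.ne'
  have hz : ((x : ℂ) + I * ξ) * (x - I * ξ) = x ^ 2 + ξ ^ 2 := by
    linear_combination (-(ξ : ℂ) ^ 2) * Complex.I_sq
  induction n with
  | zero =>
    refine ⟨by simp, ?_⟩
    rw [hermWigner_succ_left hħ]
    simp only [CharP.cast_eq_zero, mul_zero, zero_mul, sub_zero, lagSum_zero, pow_zero,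
      Nat.factorial_zero, Nat.cast_one]
    push_cast
    field_simp
    linear_combination hermWigner ħ 0 0 x ξ * hz
  | succ n ih =>
    set s := 2 * (x ^ 2 + ξ ^ 2) / ħ with hs
    have hsc : (ħ : ℂ) * (s : ℂ) = 2 * (x ^ 2 + ξ ^ 2) := by
      rw [hs]
      push_cast
      field_simp
    have h1 : hermWigner ħ (n + 1) (n + 1) x ξ = hermWigner ħ 0 0 x ξ *
        ((2 * ħ) ^ (n + 1) * (n + 1).factorial * lag (n + 1) s : ℝ) := by
      rw [hermWigner_succ_right hħ, mul_assoc, ih.2, Nat.add_sub_cancel, ih.1,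
        ← lag_succ_add, Nat.factorial_succ]
      push_cast
      ring
    refine ⟨h1, ?_⟩
    rw [hermWigner_succ_left hħ, mul_sub, h1, Nat.add_sub_cancel]
    have h2 : ((x : ℂ) + I * ξ) * (2 * ((n + 1 : ℕ) : ℂ) * ħ * hermWigner ħ (n + 1) n x ξ)
        = 2 * ((n + 1 : ℕ) : ℂ) * ħ * ((x + I * ξ) * hermWigner ħ (n + 1) n x ξ) := by ring
    rw [h2, ih.2, lagSum_succ, Nat.factorial_succ]
    push_cast
    linear_combination (hermWigner ħ 0 0 x ξ * ((2 * ħ) ^ (n + 1) * ((n + 1) * n.factorial)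
      * lag (n + 1) s)) * (2 * hz - hsc)

/-- The Wigner function of a normalized Hermite function. -/
theorem hermWigner_div_normSq (hħ : 0 < ħ) (n : ℕ) (x ξ : ℝ) :
    hermWigner ħ n n x ξ / (hermNormSq ħ n : ℂ) = ((2 * (Real.exp (-((x ^ 2 + ξ ^ 2) / ħ))
      * lag n (2 * (x ^ 2 + ξ ^ 2) / ħ)) : ℝ) : ℂ) := by
  have h := hermNormSq_pos hħ n
  rw [(hermWigner_diag hħ n x ξ).1, hermWigner_zero_zero hħ, ← Complex.ofReal_mul,
    ← Complex.ofReal_div]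
  congr 1
  rw [div_eq_iff h.ne', hermNormSq]
  ring

/-- The phase has modulus one and `|ab| ≤ (a² + b²)/2`; the scaling by `1/2` in `v` produces the
factor 2. -/
theorem norm_hermWigner_le (hħ : 0 < ħ) (n : ℕ) (x ξ : ℝ) :
    ‖hermWigner ħ n n x ξ‖ ≤ 2 * hermNormSq ħ n := by
  set g : ℝ → ℝ := fun x => hermFun ħ n x * hermFun ħ n x with hg
  have hgi : Integrable g := integrable_hermFun_mul hħ n n
  have hgI : ∫ x, g x = hermNormSq ħ n := by
    rw [hg, integral_hermFun_mul hħ, if_pos rfl]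
  have h1 := integrable_comp_add_half hgi x
  have h2 := integrable_comp_sub_half hgi x
  have e1 : ∫ v, g (x + 1 / 2 * v) = 2 * hermNormSq ħ n := by
    rw [Measure.integral_comp_mul_left (fun v => g (x + v)) (1 / 2 : ℝ), integral_add_left_eq_self, hgI]
    norm_num
  have e2 : ∫ v, g (x - 1 / 2 * v) = 2 * hermNormSq ħ n := by
    rw [Measure.integral_comp_mul_left (fun v => g (x - v)) (1 / 2 : ℝ), integral_sub_left_eq_self, hgI]
    norm_num
  calc ‖hermWigner ħ n n x ξ‖
      ≤ ∫ v, (1 / 2 * g (x + 1 / 2 * v) + 1 / 2 * g (x - 1 / 2 * v)) := by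
        refine norm_integral_le_of_norm_le ((h1.const_mul _).add (h2.const_mul _))
          (Eventually.of_forall fun v => ?_)
        rw [norm_hermCross, abs_le]
        simp only [hg]
        constructor
        · nlinarith [sq_nonneg (hermFun ħ n (x + 1 / 2 * v) + hermFun ħ n (x - 1 / 2 * v))]
        · nlinarith [sq_nonneg (hermFun ħ n (x + 1 / 2 * v) - hermFun ħ n (x - 1 / 2 * v))]
    _ = 2 * hermNormSq ħ n := by
        rw [integral_add (h1.const_mul _) (h2.const_mul _), integral_const_mul,
          integral_const_mul, e1, e2]
        ring

/-- Twice the Laguerre function is the Wigner integral of a normalized Hermite state at `ħ = 1` and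
the point `(√(s/2), 0)`, and such an integral is at most 2. -/
theorem abs_exp_mul_lag_le_one (n : ℕ) {s : ℝ} (hs : 0 ≤ s) :
    |Real.exp (-(s / 2)) * lag n s| ≤ 1 := by
  have h := hermWigner_div_normSq one_pos n (Real.sqrt (s / 2)) 0
  have h1 := norm_hermWigner_le one_pos n (Real.sqrt (s / 2)) 0
  have h2 := hermNormSq_pos one_pos n
  have h3 := congrArg norm h
  rw [norm_div, Complex.norm_real, Complex.norm_real, Real.norm_of_nonneg h2.le,
    div_eq_iff h2.ne', Real.norm_eq_abs, Real.sq_sqrt (by positivity)] at h3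
  rw [h3] at h1
  have h4 := le_of_mul_le_mul_right h1 h2
  rw [abs_mul] at h4
  simp only [ne_eq, OfNat.ofNat_ne_zero, not_false_eq_true, zero_pow, add_zero, div_one] at h4
  rw [mul_div_cancel₀ s (two_ne_zero)] at h4
  rw [abs_of_pos (by norm_num : (0 : ℝ) < 2)] at h4
  linarith

end

end WignerOsc
-- Laguerre functions in the oscillatory region.
namespace WignerOsc

noncomputable section

/-- The Laguerre function `exp (-s/2) (-1)ⁿ Lₙ(s)`. -/
def lagFun (n : ℕ) (s : ℝ) : ℝ := Real.exp (-(s / 2)) * lag n s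

/-- The function `s (d/ds) lagFun n s`. -/
def lagFlux (n : ℕ) (s : ℝ) : ℝ :=
  Real.exp (-(s / 2)) * (s * lagDeriv n s - s * lag n s / 2)

theorem hasDerivAt_exp_neg_half (s : ℝ) :
    HasDerivAt (fun s : ℝ => Real.exp (-(s / 2))) (Real.exp (-(s / 2)) * (-(1 / 2))) s :=
  ((hasDerivAt_id s).div_const 2).neg.exp

theorem hasDerivAt_lagFun (n : ℕ) {s : ℝ} (hs : s ≠ 0) :
    HasDerivAt (lagFun n) (lagFlux n s / s) s := by
  refine ((hasDerivAt_exp_neg_half s).mul (hasDerivAt_lag n s)).congr_deriv ?_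
  rw [lagFlux]
  field_simp
  ring

theorem hasDerivAt_mul_lagFun (n : ℕ) (s : ℝ) :
    HasDerivAt (fun s => s * lagFun n s) (lagFun n s + lagFlux n s) s := by
  refine ((hasDerivAt_id s).mul
    ((hasDerivAt_exp_neg_half s).mul (hasDerivAt_lag n s))).congr_deriv ?_
  simp only [lagFlux, lagFun, id, Pi.mul_apply]
  ring

theorem hasDerivAt_lagFlux (n : ℕ) (s : ℝ) :
    HasDerivAt (lagFlux n) (-((4 * n + 2 - s) / 4 * lagFun n s)) s := by
  have h1 := ((hasDerivAt_id s).mul (hasDerivAt_lag n s)).div_const 2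
  refine ((hasDerivAt_exp_neg_half s).mul ((hasDerivAt_mul_lagDeriv n s).sub h1)).congr_deriv ?_
  simp only [lagFun, id, Pi.sub_apply, Pi.mul_apply]
  ring

/-- The flux vanishes at 0, and the uniform bound on `lagFun` controls its derivative up to the
turning point. This supplies initial data for the energy estimate. -/
theorem abs_lagFlux_le (n : ℕ) {s : ℝ} (hs : 0 ≤ s) (hs' : s ≤ 4 * n + 2) :
    |lagFlux n s| ≤ (4 * n + 2) / 4 * s := by
  have h := (convex_Icc (0 : ℝ) s).norm_image_sub_le_of_norm_hasDerivWithin_le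
    (f := lagFlux n) (C := (4 * n + 2) / 4)
    (fun t _ => (hasDerivAt_lagFlux n t).hasDerivWithinAt)
    (fun t ht => by
      have h1 := abs_exp_mul_lag_le_one n ht.1
      have h2 : 0 ≤ (4 * n + 2 - t) / 4 := by linarith [ht.2]
      rw [norm_neg, Real.norm_eq_abs, abs_mul, abs_of_nonneg h2]
      calc (4 * n + 2 - t) / 4 * |lagFun n t| ≤ (4 * n + 2 - t) / 4 * 1 := by
            gcongr
            exact h1
        _ ≤ _ := by linarith [ht.1])
    (Set.left_mem_Icc.mpr hs) (Set.right_mem_Icc.mpr hs)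
  have h0 : lagFlux n 0 = 0 := by simp [lagFlux]
  rwa [h0, sub_zero, sub_zero, Real.norm_eq_abs, Real.norm_of_nonneg hs] at h

/-- Sonine's energy functional for the Laguerre functions. -/
def lagEnergy (n : ℕ) (s : ℝ) : ℝ :=
  Real.sqrt s * ((4 * n + 2 - s) * lagFun n s ^ 2 +
    (lagFun n s ^ 2 / 2 + 2 * lagFun n s * lagFlux n s + 4 * lagFlux n s ^ 2) / s)

/-- The weight `√s` and the lower-order terms are chosen so that all cross terms cancel, leaving
minus a sum of squares; hence the energy decreases. -/
theorem hasDerivAt_lagEnergy (n : ℕ) {s : ℝ} (hs : 0 < s) :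
    HasDerivAt (lagEnergy n)
      (-(Real.sqrt s * (lagFun n s ^ 2 + lagFun n s ^ 2 / (4 * s ^ 2)))) s := by
  have hu := hasDerivAt_lagFun n hs.ne'
  have hp := hasDerivAt_lagFlux n s
  have h1 := ((hasDerivAt_id s).const_sub (4 * n + 2 : ℝ)).mul (hu.pow 2)
  have h2 := (((hu.pow 2).div_const 2).add ((hu.const_mul 2).mul hp)).add ((hp.pow 2).const_mul 4)
  have h3 := (Real.hasDerivAt_sqrt hs.ne').mul (h1.add (h2.div (hasDerivAt_id s) hs.ne'))
  refine h3.congr_deriv ?_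
  have hr : 0 < Real.sqrt s := Real.sqrt_pos.mpr hs
  have hr2 : s = Real.sqrt s ^ 2 := (Real.sq_sqrt hs.le).symm
  simp only [id, Pi.add_apply, Pi.mul_apply, Pi.div_apply, Pi.pow_apply]
  generalize lagFun n s = u
  generalize lagFlux n s = p
  generalize Real.sqrt s = r at hr hr2
  subst hr2
  field_simp
  ring

/-- Monotonicity reduces the bound to `s = 1/ν`, where `|u| ≤ 1` and `|p| ≤ 1/4`: the bracket is
then at most `9ν/4` and the prefactor is `ν^{-1/2}`. -/
theorem lagEnergy_le (n : ℕ) {s : ℝ} (hs : 1 ≤ s) :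
    lagEnergy n s ≤ 9 / 4 * Real.sqrt (4 * n + 2) := by
  set ν : ℝ := 4 * n + 2 with hν
  have hν2 : 2 ≤ ν := by
    rw [hν]
    linarith [(Nat.cast_nonneg n : (0 : ℝ) ≤ n)]
  have hν0 : 0 < ν := by linarith
  have hs0 : 0 < ν⁻¹ := inv_pos.mpr hν0
  have hs1 : ν⁻¹ ≤ 1 := inv_le_one_of_one_le₀ (by linarith)
  have hanti : AntitoneOn (lagEnergy n) (Set.Ici ν⁻¹) := by
    refine antitoneOn_of_deriv_nonpos (convex_Ici _) ?_ ?_ ?_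
    · exact fun t ht => (hasDerivAt_lagEnergy n (hs0.trans_le ht)).continuousAt.continuousWithinAt
    · intro t ht
      rw [interior_Ici] at ht
      exact (hasDerivAt_lagEnergy n (hs0.trans ht)).differentiableAt.differentiableWithinAt
    · intro t ht
      rw [interior_Ici] at ht
      rw [(hasDerivAt_lagEnergy n (hs0.trans ht)).deriv, neg_nonpos]
      positivity
  refine (hanti Set.self_mem_Ici (Set.mem_Ici.mpr (hs1.trans hs)) (hs1.trans hs)).trans ?_
  have hu := abs_exp_mul_lag_le_one n hs0.le
  have hp := abs_lagFlux_le n hs0.le (by rw [← hν]; linarith)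
  rw [← hν] at hp
  rw [show ν / 4 * ν⁻¹ = 1 / 4 by field_simp] at hp
  change |lagFun n ν⁻¹| ≤ 1 at hu
  rw [lagEnergy, ← hν, div_inv_eq_mul]
  generalize lagFun n ν⁻¹ = u at hu
  generalize lagFlux n ν⁻¹ = p at hp
  have h1 : u ^ 2 ≤ 1 := by
    rw [← sq_abs]
    nlinarith [abs_nonneg u]
  have h2 : p ^ 2 ≤ 1 / 16 := by
    rw [← sq_abs]
    nlinarith [abs_nonneg p]
  have h3 : u * p ≤ 1 / 4 := by
    refine (le_abs_self _).trans ?_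
    rw [abs_mul]
    nlinarith [abs_nonneg u, abs_nonneg p]
  have h4 : (ν - ν⁻¹) * u ^ 2 + (u ^ 2 / 2 + 2 * u * p + 4 * p ^ 2) * ν ≤ 9 / 4 * ν := by
    nlinarith [mul_nonneg hs0.le (sq_nonneg u)]
  have hr : 0 < Real.sqrt ν := Real.sqrt_pos.mpr hν0
  calc Real.sqrt ν⁻¹ * ((ν - ν⁻¹) * u ^ 2 + (u ^ 2 / 2 + 2 * u * p + 4 * p ^ 2) * ν)
      ≤ Real.sqrt ν⁻¹ * (9 / 4 * ν) := by gcongr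
    _ = 9 / 4 * Real.sqrt ν := by
        rw [Real.sqrt_inv]
        field_simp
        rw [Real.sq_sqrt hν0.le]

/-- In the oscillatory region the Laguerre functions are `O(ν ^ (-1/2))`. -/
theorem exists_lagFun_lagFlux_bound {a b : ℝ} (ha : 0 < a) (hb : b < 1) :
    ∃ K : ℝ, 0 ≤ K ∧ ∀ (n : ℕ) (s : ℝ), 1 ≤ s → a * (4 * n + 2) ≤ s → s ≤ b * (4 * n + 2) →
      |lagFun n s| ≤ K / Real.sqrt (4 * n + 2) ∧ |lagFlux n s| ≤ K * Real.sqrt (4 * n + 2) := by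
  set k : ℝ := 9 / 4 / Real.sqrt a with hk
  have hra : 0 < Real.sqrt a := Real.sqrt_pos.mpr ha
  have hk0 : 0 < k := by positivity
  have hb' : 0 < 1 - b := by linarith
  have hkb : 0 < k / (1 - b) := by positivity
  refine ⟨k / (1 - b) + 4 * k + 3, by positivity, fun n s hs h1 h2 => ?_⟩
  have hE := lagEnergy_le n hs
  have hu1 := abs_exp_mul_lag_le_one n (by linarith : 0 ≤ s)
  change |lagFun n s| ≤ 1 at hu1
  rw [lagEnergy] at hE
  have hν2 : 2 ≤ (4 * n + 2 : ℝ) := by linarith [(Nat.cast_nonneg n : (0 : ℝ) ≤ n)]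
  generalize (4 * n + 2 : ℝ) = ν at *
  generalize lagFun n s = u at *
  generalize lagFlux n s = p at *
  have hν0 : 0 < ν := by linarith
  have hr : 0 < Real.sqrt ν := Real.sqrt_pos.mpr hν0
  have hr1 : 1 ≤ Real.sqrt ν := Real.one_le_sqrt.mpr (by linarith)
  have hr2 : Real.sqrt ν ^ 2 = ν := Real.sq_sqrt hν0.le
  have hsq : Real.sqrt a * Real.sqrt ν ≤ Real.sqrt s := by
    rw [← Real.sqrt_mul ha.le]
    exact Real.sqrt_le_sqrt h1
  have hs0 : 0 < s := by linarith
  have hsν : s ≤ ν := by nlinarith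
  -- Completing the square makes every term of the bracket nonnegative for `s ≤ ν`, so each is
  -- bounded separately.
  have hid : (ν - s) * u ^ 2 + (u ^ 2 / 2 + 2 * u * p + 4 * p ^ 2) / s
      = (ν - s) * u ^ 2 + u ^ 2 / (4 * s) + (u + 4 * p) ^ 2 / (4 * s) := by
    field_simp
    ring
  have hpos1 : 0 ≤ (ν - s) * u ^ 2 := mul_nonneg (by linarith) (sq_nonneg u)
  have hpos2 : 0 ≤ u ^ 2 / (4 * s) := by positivity
  have hpos3 : 0 ≤ (u + 4 * p) ^ 2 / (4 * s) := by positivity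
  rw [hid] at hE
  have hΨ : (ν - s) * u ^ 2 + u ^ 2 / (4 * s) + (u + 4 * p) ^ 2 / (4 * s) ≤ k := by
    rw [hk, le_div_iff₀ hra]
    refine le_of_mul_le_mul_right ?_ hr
    refine le_trans ?_ hE
    rw [mul_assoc, mul_comm]
    gcongr
  have hu : |u| ≤ (k / (1 - b) + 1) / Real.sqrt ν := by
    refine abs_le_of_sq_le_sq ?_ (by positivity)
    rw [div_pow, hr2, le_div_iff₀ hν0]
    have h3 : (1 - b) * ν * u ^ 2 ≤ k := by
      have : (1 - b) * ν * u ^ 2 ≤ (ν - s) * u ^ 2 := by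
        gcongr
        linarith
      linarith
    have h4 : u ^ 2 * ν ≤ k / (1 - b) := by
      rw [le_div_iff₀ hb']
      linarith
    nlinarith
  have hp : |u + 4 * p| ≤ (4 * k + 1) * Real.sqrt ν := by
    refine abs_le_of_sq_le_sq ?_ (by positivity)
    have h3 : (u + 4 * p) ^ 2 ≤ k * (4 * s) := by
      rw [← div_le_iff₀ (by positivity)]
      linarith
    rw [mul_pow, hr2]
    nlinarith [mul_nonneg hk0.le hν0.le, mul_nonneg (mul_nonneg hk0.le hk0.le) hν0.le]
  constructor
  · refine hu.trans ?_
    gcongr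
    · linarith
    · norm_num
  · have h3 : |4 * p| ≤ |u + 4 * p| + |u| := by
      have := abs_sub (u + 4 * p) u
      rwa [add_sub_cancel_left] at this
    rw [abs_mul, abs_of_pos (by norm_num : (0 : ℝ) < 4)] at h3
    have h4 : 0 ≤ k / (1 - b) * Real.sqrt ν := by positivity
    have h5 : 0 ≤ k * Real.sqrt ν := by positivity
    nlinarith

/-- The partial sums of index zero are `1 + O(ν ^ (-1/2))` in the oscillatory region. -/
theorem exists_genLagSum_zero_bound {a b : ℝ} (ha : 0 < a) (hb : b < 1) :
    ∃ K : ℝ, 0 ≤ K ∧ ∀ (n : ℕ) (s : ℝ), 1 ≤ s → a * (4 * n + 2) ≤ s → s ≤ b * (4 * n + 2) →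
      |Real.exp (-(s / 2)) * genLagSum 0 (n + 1) s - 1| ≤ K / Real.sqrt (4 * n + 2) := by
  obtain ⟨K, hK, hbound⟩ := exists_lagFun_lagFlux_bound ha hb
  set c : ℝ := (1 - b) / 4 with hc
  have hc0 : 0 < c := by
    rw [hc]
    linarith
  set k : ℝ := 1 / (4 * c ^ 2) + 1 / (8 * c ^ 3) with hk
  have hk0 : 0 < k := by positivity
  refine ⟨k + (K / c + 1 / (4 * c ^ 2)), by positivity, fun n s hs h1 h2 => ?_⟩
  have hp := (hbound n s hs h1 h2).2
  have hu1 := abs_exp_mul_lag_le_one n (by linarith : 0 ≤ s)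
  have hν2 : 2 ≤ (4 * n + 2 : ℝ) := by linarith [(Nat.cast_nonneg n : (0 : ℝ) ≤ n)]
  set ν : ℝ := 4 * n + 2 with hν
  have hν0 : 0 < ν := by linarith
  have hs0 : 0 < s := by linarith
  have hsν : s ≤ ν := by nlinarith
  have hQ : ∀ t ∈ Set.Icc 0 s, c * ν ≤ (ν - t) / 4 := by
    intro t ht
    rw [hc]
    linarith [ht.2]
  have hQ0 : ∀ t ∈ Set.Icc 0 s, (ν - t) / 4 ≠ 0 := fun t ht =>
    ((mul_pos hc0 hν0).trans_le (hQ t ht)).ne'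
  -- The correctors come from two integrations by parts. With `Q = (ν - t)/4` the flux has
  -- derivative `-Q u`, so the first corrector cancels `-½u`; the second removes the resulting flux
  -- term `p/(4Q²)`. What is left of `g'` is `O(ν⁻²)`.
  set g : ℝ → ℝ := fun t => Real.exp (-(t / 2)) * genLagSum 0 (n + 1) t
    - 1 / 2 * (lagFlux n t / ((ν - t) / 4) - t * lagFun n t / (4 * ((ν - t) / 4) ^ 2)) with hg
  have hgd : ∀ t ∈ Set.Icc 0 s, HasDerivAt g
      (1 / 2 * lagFun n t * (1 / (4 * ((ν - t) / 4) ^ 2) + t / (8 * ((ν - t) / 4) ^ 3))) t := by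
    intro t ht
    have h3 := (hasDerivAt_exp_neg_half t).mul (hasDerivAt_genLagSum_zero n t)
    have h4 : HasDerivAt (fun t => (ν - t) / 4) (-1 / 4) t :=
      ((hasDerivAt_id t).const_sub ν).div_const 4
    have h5 := (hasDerivAt_lagFlux n t).div h4 (hQ0 t ht)
    have h6 := (hasDerivAt_mul_lagFun n t).div ((h4.pow 2).const_mul 4)
      (mul_ne_zero four_ne_zero (pow_ne_zero 2 (hQ0 t ht)))
    refine (h3.sub ((h5.sub h6).const_mul (1 / 2))).congr_deriv ?_
    have h7 := hQ0 t ht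
    have h8 : Real.exp (-(t / 2)) * lag n t = lagFun n t := rfl
    simp only [← hν, Pi.pow_apply]
    have h9 : t = ν - 4 * ((ν - t) / 4) := by ring
    generalize (ν - t) / 4 = Q at h7 h9
    subst h9
    field_simp
    rw [← h8]
    ring
  have hmv := (convex_Icc (0 : ℝ) s).norm_image_sub_le_of_norm_hasDerivWithin_le
    (f := g) (C := k / ν ^ 2) (fun t ht => (hgd t ht).hasDerivWithinAt)
    (fun t ht => by
      have h3 := abs_exp_mul_lag_le_one n ht.1
      change |lagFun n t| ≤ 1 at h3
      have h4 := hQ t ht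
      have h5 : 0 < c * ν := mul_pos hc0 hν0
      have h6 : 0 < (ν - t) / 4 := h5.trans_le h4
      have h7 : 1 / (4 * ((ν - t) / 4) ^ 2) ≤ 1 / (4 * (c * ν) ^ 2) := by gcongr
      have h8 : t / (8 * ((ν - t) / 4) ^ 3) ≤ ν / (8 * (c * ν) ^ 3) := by
        have := ht.2
        gcongr
        linarith
      have h9 : 1 / (4 * (c * ν) ^ 2) + ν / (8 * (c * ν) ^ 3) = k / ν ^ 2 := by
        rw [hk]
        field_simp
      have h10 : 0 ≤ 1 / (4 * ((ν - t) / 4) ^ 2) + t / (8 * ((ν - t) / 4) ^ 3) := by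
        have := ht.1
        positivity
      rw [Real.norm_eq_abs, abs_mul, abs_mul, abs_of_nonneg h10,
        abs_of_pos (by norm_num : (0 : ℝ) < 1 / 2)]
      calc 1 / 2 * |lagFun n t| * (1 / (4 * ((ν - t) / 4) ^ 2) + t / (8 * ((ν - t) / 4) ^ 3))
          ≤ 1 * (1 / (4 * ((ν - t) / 4) ^ 2) + t / (8 * ((ν - t) / 4) ^ 3)) := by
            gcongr
            linarith
        _ ≤ _ := by linarith)
    (Set.left_mem_Icc.mpr hs0.le) (Set.right_mem_Icc.mpr hs0.le)
  have hg0 : g 0 = 1 := by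
    simp [hg, genLagSum_zero_left_zero, lagFlux]
  rw [hg0, sub_zero, Real.norm_eq_abs, Real.norm_of_nonneg hs0.le] at hmv
  have hr : 0 < Real.sqrt ν := Real.sqrt_pos.mpr hν0
  have hr1 : 1 ≤ Real.sqrt ν := Real.one_le_sqrt.mpr (by linarith)
  have hr2 : Real.sqrt ν ^ 2 = ν := Real.sq_sqrt hν0.le
  have hrν : 1 / ν ≤ 1 / Real.sqrt ν := by
    gcongr
    nlinarith
  have hQs := hQ s ⟨hs0.le, le_rfl⟩
  have hcν : 0 < c * ν := mul_pos hc0 hν0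
  have hQs0 : 0 < (ν - s) / 4 := hcν.trans_le hQs
  have b1 : |lagFlux n s / ((ν - s) / 4)| ≤ K / c * (1 / Real.sqrt ν) := by
    rw [abs_div, abs_of_pos hQs0]
    calc |lagFlux n s| / ((ν - s) / 4) ≤ K * Real.sqrt ν / (c * ν) := by gcongr
      _ = K / c * (1 / Real.sqrt ν) := by
        nth_rewrite 2 [← hr2]
        field_simp
  have b2 : |s * lagFun n s / (4 * ((ν - s) / 4) ^ 2)| ≤ 1 / (4 * c ^ 2) * (1 / Real.sqrt ν) := by
    rw [abs_div, abs_mul, abs_of_pos hs0, abs_of_pos (by positivity : 0 < 4 * ((ν - s) / 4) ^ 2)]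
    calc s * |lagFun n s| / (4 * ((ν - s) / 4) ^ 2) ≤ ν * 1 / (4 * (c * ν) ^ 2) := by
          gcongr
          exact hu1
      _ = 1 / (4 * c ^ 2) * (1 / ν) := by field_simp
      _ ≤ _ := by gcongr
  have b3 : k / ν ^ 2 * s ≤ k * (1 / Real.sqrt ν) := by
    calc k / ν ^ 2 * s ≤ k / ν ^ 2 * ν := by gcongr
      _ = k * (1 / ν) := by field_simp
      _ ≤ _ := by gcongr
  have hfin : Real.exp (-(s / 2)) * genLagSum 0 (n + 1) s - 1 = (g s - 1)
      + 1 / 2 * (lagFlux n s / ((ν - s) / 4) - s * lagFun n s / (4 * ((ν - s) / 4) ^ 2)) := by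
    rw [hg]
    ring
  have h3 := abs_add_le (g s - 1)
    (1 / 2 * (lagFlux n s / ((ν - s) / 4) - s * lagFun n s / (4 * ((ν - s) / 4) ^ 2)))
  have h4 := abs_sub (lagFlux n s / ((ν - s) / 4)) (s * lagFun n s / (4 * ((ν - s) / 4) ^ 2))
  rw [← hfin, abs_mul, abs_of_pos (by norm_num : (0 : ℝ) < 1 / 2)] at h3
  have h5 : (k + (K / c + 1 / (4 * c ^ 2))) / Real.sqrt ν = k * (1 / Real.sqrt ν)
      + (K / c * (1 / Real.sqrt ν) + 1 / (4 * c ^ 2) * (1 / Real.sqrt ν)) := by ring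
  rw [h5]
  linarith [abs_nonneg (lagFlux n s / ((ν - s) / 4)),
    abs_nonneg (s * lagFun n s / (4 * ((ν - s) / 4) ^ 2))]

/-- Bounds on Laguerre functions of index zero and one propagate to all indices. -/
theorem exists_genLag_propagation {A : ℝ} (hA : 0 ≤ A) (k : ℕ) :
    ∃ C : ℝ, 0 ≤ C ∧ ∀ (n : ℕ) (s B : ℝ), 1 ≤ s → n ≤ A * s →
      |Real.exp (-(s / 2)) * genLag 0 n s| ≤ B → |Real.exp (-(s / 2)) * genLag 1 n s| ≤ B →
      |Real.exp (-(s / 2)) * genLag k n s| ≤ C * B := by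
  -- The recurrence in the index is of second order, so the induction carries two consecutive
  -- indices.
  suffices h : ∃ C : ℝ, 0 ≤ C ∧ ∀ (n : ℕ) (s B : ℝ), 1 ≤ s → n ≤ A * s →
      |Real.exp (-(s / 2)) * genLag 0 n s| ≤ B → |Real.exp (-(s / 2)) * genLag 1 n s| ≤ B →
      |Real.exp (-(s / 2)) * genLag k n s| ≤ C * B ∧
      |Real.exp (-(s / 2)) * genLag (k + 1) n s| ≤ C * B by
    obtain ⟨C, hC, h⟩ := h
    exact ⟨C, hC, fun n s B h1 h2 h3 h4 => (h n s B h1 h2 h3 h4).1⟩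
  induction k with
  | zero => exact ⟨1, zero_le_one, fun n s B _ _ h0 h1 => by
      rw [one_mul]
      exact ⟨h0, h1⟩⟩
  | succ k ih =>
    obtain ⟨C, hC, h⟩ := ih
    refine ⟨(1 + A + 2 * k) * C, by positivity, fun n s B hs hn h0 h1 => ?_⟩
    obtain ⟨e0, e1⟩ := h n s B hs hn h0 h1
    have hB : 0 ≤ B := (abs_nonneg _).trans h0
    have hk : (0 : ℝ) ≤ k := Nat.cast_nonneg k
    have hCB : 0 ≤ C * B := mul_nonneg hC hB
    have hs0 : 0 < s := by linarith
    refine ⟨e1.trans ?_, ?_⟩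
    · nlinarith [mul_nonneg hA hCB, mul_nonneg hk hCB]
    · have hrec := genLag_recurrence k n s
      set x := Real.exp (-(s / 2)) * genLag k n s
      set y := Real.exp (-(s / 2)) * genLag (k + 1) n s
      have h2 : s * (Real.exp (-(s / 2)) * genLag (k + 1 + 1) n s) = (s + k) * y - (n + k) * x := by
        linear_combination Real.exp (-(s / 2)) * hrec
      have h3 : s * |Real.exp (-(s / 2)) * genLag (k + 1 + 1) n s|
          ≤ (s + k) * |y| + (n + k) * |x| := by
        rw [← abs_of_pos hs0, ← abs_mul, abs_of_pos hs0, h2]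
        refine (abs_sub _ _).trans ?_
        rw [abs_mul (s + k), abs_mul ((n : ℝ) + k), abs_of_nonneg (by positivity : 0 ≤ s + k),
          abs_of_nonneg (by positivity : (0 : ℝ) ≤ n + k)]
      refine le_of_mul_le_mul_left (h3.trans ?_) hs0
      calc (s + k) * |y| + (n + k) * |x| ≤ (s + k * s) * (C * B) + (A * s + k * s) * (C * B) := by
            gcongr
            · nlinarith
            · nlinarith
        _ = s * ((1 + A + 2 * k) * C * B) := by ring

/-- The partial sums of the generating series at `1` are `1 + O(ν ^ (-1/2))` in the
oscillatory region. -/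
theorem exists_genLagSum_bound (d : ℕ) {a b : ℝ} (ha : 0 < a) (hb : b < 1) :
    ∃ K : ℝ, 0 ≤ K ∧ ∀ (n : ℕ) (s : ℝ), 1 ≤ n → 1 ≤ s → a * (4 * n + 2) ≤ s →
      s ≤ b * (4 * n + 2) →
      |2 ^ d * (Real.exp (-(s / 2)) * genLagSum d (n + 1) s) - 1| ≤ K / Real.sqrt (4 * n + 2) := by
  obtain ⟨K, hK, hbound⟩ := exists_lagFun_lagFlux_bound ha hb
  obtain ⟨K₀, hK₀, hbound₀⟩ := exists_genLagSum_zero_bound ha hb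
  choose C hC hprop using exists_genLag_propagation (A := 1 / a) (by positivity)
  refine ⟨K₀ + ∑ k ∈ Finset.range d, 2 ^ k * (C (k + 1) * (9 * K)), ?_, fun n s hn hs h1 h2 => ?_⟩
  · have : 0 ≤ ∑ k ∈ Finset.range d, 2 ^ k * (C (k + 1) * (9 * K)) :=
      Finset.sum_nonneg fun k _ => by
        have := hC (k + 1)
        positivity
    linarith
  have e0 := hbound₀ n s hs h1 h2
  obtain ⟨hu, hp⟩ := hbound n s hs h1 h2
  have hn1 : (1 : ℝ) ≤ n := by exact_mod_cast hn
  have hns : (n : ℝ) ≤ 1 / a * s := by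
    rw [div_mul_eq_mul_div, one_mul, le_div_iff₀ ha]
    nlinarith
  set ν : ℝ := 4 * n + 2 with hν
  have hν0 : 0 < ν := by linarith
  have hr : 0 < Real.sqrt ν := Real.sqrt_pos.mpr hν0
  have hr2 : Real.sqrt ν ^ 2 = ν := Real.sq_sqrt hν0.le
  have hsν : s ≤ ν := by nlinarith
  have hx1 : |Real.exp (-(s / 2)) * genLag 1 n s| ≤ 9 * K / Real.sqrt ν := by
    rw [genLag_one]
    refine hu.trans ?_
    gcongr
    linarith
  have hx0 : |Real.exp (-(s / 2)) * genLag 0 n s| ≤ 9 * K / Real.sqrt ν := by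
    -- Index zero is expressed through the flux, which is `O(√ν)`; division by `n ≥ ν/6`, valid
    -- since `n ≥ 1`, brings it to `O(1/√ν)`.
    have h3 : n * (Real.exp (-(s / 2)) * genLag 0 n s) = lagFlux n s + s / 2 * lagFun n s := by
      have := genLag_zero_left n s
      rw [lagFlux, lagFun]
      linear_combination Real.exp (-(s / 2)) * this
    have h4 : n * |Real.exp (-(s / 2)) * genLag 0 n s| ≤ 3 / 2 * K * Real.sqrt ν := by
      rw [← abs_of_pos (by linarith : (0 : ℝ) < n), ← abs_mul, h3]
      refine (abs_add_le _ _).trans ?_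
      rw [abs_mul, abs_of_pos (by linarith : 0 < s / 2)]
      have h5 : s / 2 * |lagFun n s| ≤ ν / 2 * (K / Real.sqrt ν) := by gcongr
      have h6 : ν / 2 * (K / Real.sqrt ν) = 1 / 2 * K * Real.sqrt ν := by
        nth_rewrite 1 [← hr2]
        field_simp
      linarith
    rw [le_div_iff₀ hr]
    have h7 : ν / 6 ≤ n := by linarith
    have h8 : ν / 6 * |Real.exp (-(s / 2)) * genLag 0 n s| ≤ 3 / 2 * K * Real.sqrt ν :=
      (mul_le_mul_of_nonneg_right h7 (abs_nonneg _)).trans h4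
    nth_rewrite 1 [← hr2] at h8
    refine le_of_mul_le_mul_right ?_ hr
    linarith
  have hid : 2 ^ d * (Real.exp (-(s / 2)) * genLagSum d (n + 1) s) - 1
      = (Real.exp (-(s / 2)) * genLagSum 0 (n + 1) s - 1)
        + ∑ k ∈ Finset.range d, 2 ^ k * (Real.exp (-(s / 2)) * genLag (k + 1) n s) := by
    have h3 := pow_mul_genLagSum d n s
    have h4 : ∑ k ∈ Finset.range d, 2 ^ k * (Real.exp (-(s / 2)) * genLag (k + 1) n s)
        = Real.exp (-(s / 2)) * ∑ k ∈ Finset.range d, 2 ^ k * genLag (k + 1) n s := by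
      rw [Finset.mul_sum]
      exact Finset.sum_congr rfl fun k _ => by ring
    rw [h4]
    linear_combination Real.exp (-(s / 2)) * h3
  rw [hid, add_div, Finset.sum_div]
  refine (abs_add_le _ _).trans (add_le_add e0 ((Finset.abs_sum_le_sum_abs _ _).trans
    (Finset.sum_le_sum fun k _ => ?_)))
  rw [abs_mul, abs_of_pos (by positivity : (0 : ℝ) < 2 ^ k), mul_div_assoc, mul_div_assoc]
  gcongr
  exact hprop (k + 1) n s _ hs hns hx0 hx1

/-! ### Laguerre functions in the forbidden region. -/

/-- In the forbidden region the signed Laguerre polynomials grow geometrically. -/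
theorem lag_growth {ρ s : ℝ} (hρ : 1 < ρ) {M : ℕ} (hM : (ρ + 1) ^ 2 / ρ * M ≤ s) (n : ℕ)
    (hn : n < M) : 0 < lag n s ∧ ρ * lag n s ≤ lag (n + 1) s := by
  have hρ0 : 0 < ρ := by linarith
  have hs : ∀ n : ℕ, n < M → (ρ + 1) ^ 2 / ρ * (n + 1) ≤ s := by
    intro n hn
    refine le_trans ?_ hM
    gcongr
    exact_mod_cast hn
  -- In the three-term recurrence the summands `2` and `ρ⁻¹` absorb the two negative contributions,
  -- and `ρ` survives as growth rate. As `ρ → 1` the multiplier tends to 4, the slope of the turning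
  -- point.
  have hid : (ρ + 1) ^ 2 / ρ = ρ + 2 + ρ⁻¹ := by
    field_simp
    ring
  rw [hid] at hs
  have hi : 0 < ρ⁻¹ := inv_pos.mpr hρ0
  induction n with
  | zero =>
    have h := hs 0 hn
    rw [lag_succ]
    simp only [lag_zero, lagSum_zero, CharP.cast_eq_zero, zero_add, div_one, mul_one] at h ⊢
    exact ⟨one_pos, by linarith⟩
  | succ n ih =>
    obtain ⟨h0, h1⟩ := ih (by omega)
    have hpos : 0 < lag (n + 1) s := lt_of_lt_of_le (mul_pos hρ0 h0) h1
    refine ⟨hpos, ?_⟩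
    have h2 := hs (n + 1) hn
    have h3 := lag_succ_add (n + 1) s
    have h4 := lag_succ_add n s
    rw [lagSum_succ, ← h4] at h3
    push_cast at h2 h3
    have h5 : lag n s ≤ ρ⁻¹ * lag (n + 1) s := by
      rw [inv_mul_eq_div, le_div_iff₀ hρ0]
      linarith
    have hn0 : (0 : ℝ) < n + 1 + 1 := by positivity
    refine le_of_mul_le_mul_left ?_ hn0
    have h6 : (ρ + 2 + ρ⁻¹) * (n + 1 + 1) * lag (n + 1) s ≤ s * lag (n + 1) s := by gcongr
    have h7 : ((n : ℝ) + 1) * lag n s ≤ (n + 1) * (ρ⁻¹ * lag (n + 1) s) := by gcongr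
    have h8 : 0 ≤ ρ⁻¹ * lag (n + 1) s := by positivity
    nlinarith

theorem lag_pow_growth {ρ s : ℝ} (hρ : 1 < ρ) {M : ℕ} (hM : (ρ + 1) ^ 2 / ρ * M ≤ s) (n j : ℕ)
    (hn : n + j ≤ M) : ρ ^ j * lag n s ≤ lag (n + j) s := by
  induction j with
  | zero => simp
  | succ j ih =>
    have h1 := ih (by omega)
    have h2 := (lag_growth hρ hM (n + j) (by omega)).2
    rw [pow_succ, ← add_assoc]
    nlinarith

/-- Exponential smallness of the Laguerre functions of any index in the forbidden region. -/
theorem exists_genLag_forbidden_bound (d : ℕ) {ρ : ℝ} (hρ : 1 < ρ) :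
    ∃ C : ℝ, 0 ≤ C ∧ ∀ (n j : ℕ) (s : ℝ), 1 ≤ s → (ρ + 1) ^ 2 / ρ * (n + j + 1 : ℕ) ≤ s →
      |Real.exp (-(s / 2)) * genLag d n s| ≤ C * (1 / ρ) ^ j := by
  obtain ⟨C, hC, h⟩ := exists_genLag_propagation (A := 1) zero_le_one d
  have hρ0 : 0 < ρ := by linarith
  refine ⟨C * 2, by positivity, fun n j s hs hM => ?_⟩
  rw [mul_assoc]
  -- The function of degree `m + j` is at most 1 and at least `ρʲ` times that of degree `m`.
  have key : ∀ m ≤ n, |Real.exp (-(s / 2)) * lag m s| ≤ (1 / ρ) ^ j := by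
    intro m hm
    have h1 := lag_pow_growth hρ hM m j (by omega)
    have h2 := (lag_growth hρ hM m (by omega)).1
    have h3 := (le_abs_self _).trans (abs_exp_mul_lag_le_one (m + j) (by linarith : 0 ≤ s))
    have he := Real.exp_pos (-(s / 2))
    rw [abs_of_pos (mul_pos he h2), one_div, inv_pow, ← one_div, le_div_iff₀ (by positivity)]
    nlinarith
  have hx1 : |Real.exp (-(s / 2)) * genLag 1 n s| ≤ 2 * (1 / ρ) ^ j := by
    rw [genLag_one]
    have : 0 ≤ (1 / ρ) ^ j := by positivity
    linarith [key n le_rfl]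
  refine h n s _ hs ?_ ?_ hx1
  · rw [one_mul]
    refine le_trans ?_ ((le_mul_of_one_le_left (by positivity) ?_).trans hM)
    · push_cast
      linarith [(Nat.cast_nonneg j : (0 : ℝ) ≤ j)]
    · rw [one_le_div hρ0]
      nlinarith
  · cases n with
    | zero =>
      have := key 0 le_rfl
      rw [genLag_zero_right]
      rw [lag_zero] at this
      have : 0 ≤ (1 / ρ) ^ j := by positivity
      linarith
    | succ n =>
      rw [genLag_eq_add, genLag_one, genLag_one, mul_add, two_mul]
      exact (abs_add_le _ _).trans (add_le_add (key _ le_rfl) (key _ (by omega)))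

end

end WignerOsc
-- Product Hermite functions as eigenfunctions in `L²`.
namespace WignerOsc

noncomputable section

variable {d : ℕ} {ħ : ℝ}

theorem integral_prod_coord (f : Fin d → ℝ → ℂ) :
    ∫ x : Rd d, ∏ j, f j (x j) = ∏ j, ∫ t, f j t := by
  rw [← integral_fintype_prod_volume_eq_prod f]
  exact (PiLp.volume_preserving_ofLp (Fin d)).integral_comp
    (MeasurableEquiv.toLp 2 (Fin d → ℝ)).symm.measurableEmbedding (fun y => ∏ j, f j (y j))

theorem integrable_prod_coord {f : Fin d → ℝ → ℂ} (hf : ∀ j, Integrable (f j)) :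
    Integrable fun x : Rd d => ∏ j, f j (x j) :=
  ((PiLp.volume_preserving_ofLp (Fin d)).integrable_comp_emb
    (MeasurableEquiv.toLp 2 (Fin d → ℝ)).symm.measurableEmbedding).mpr
    (Integrable.fintype_prod (μ := fun _ => volume) hf)

theorem lineDeriv_prod_coord {F : Fin d → ℝ → ℝ} {x : Rd d} {j : Fin d} {f' : ℝ}
    (h : HasDerivAt (F j) f' (x j)) :
    lineDeriv ℝ (fun y : Rd d => ((∏ i, F i (y i) : ℝ) : ℂ)) x (EuclideanSpace.single j 1)
      = ((f' * ∏ i ∈ Finset.univ.erase j, F i (x i) : ℝ) : ℂ) := by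
  have h1 : (fun t : ℝ => ((∏ i, F i ((x + t • EuclideanSpace.single j (1 : ℝ)) i) : ℝ) : ℂ))
      = fun t : ℝ => ((F j (x j + t) * ∏ i ∈ Finset.univ.erase j, F i (x i) : ℝ) : ℂ) := by
    funext t
    congr 1
    rw [← Finset.mul_prod_erase _ _ (Finset.mem_univ j)]
    congr 1
    · simp
    · refine Finset.prod_congr rfl fun i hi => ?_
      have : i ≠ j := Finset.ne_of_mem_erase hi
      simp [this]
  have h2 : HasDerivAt (fun t => F j (x j + t)) f' 0 := by
    have h3 : HasDerivAt (F j) f' (x j + 0) := by rwa [add_zero]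
    exact h3.comp_const_add (x j) 0
  have h3 : HasLineDerivAt ℝ (fun y : Rd d => ((∏ i, F i (y i) : ℝ) : ℂ))
      ((f' * ∏ i ∈ Finset.univ.erase j, F i (x i) : ℝ) : ℂ) x (EuclideanSpace.single j 1) := by
    rw [HasLineDerivAt, h1]
    exact (h2.mul_const _).ofReal_comp
  exact h3.lineDeriv

/-- The product Hermite functions on `ℝᵈ` (unnormalized). -/
def hermProd (ħ : ℝ) (α : Fin d → ℕ) (x : Rd d) : ℝ := ∏ j, hermFun ħ (α j) (x j)

theorem continuous_hermProd (α : Fin d → ℕ) : Continuous (hermProd ħ α) := by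
  have := fun j => continuous_hermFun (ħ := ħ) (α j)
  unfold hermProd
  fun_prop

theorem hermProd_eq (α : Fin d → ℕ) (x : Rd d) :
    hermProd ħ α x = (∏ j, (hermPoly ħ (α j)).eval (x j)) *
      Real.exp (-(1 / (2 * ħ)) * ‖x‖ ^ 2) := by
  simp only [hermProd, hermFun]
  rw [Finset.prod_mul_distrib, ← Real.exp_sum, EuclideanSpace.norm_sq_eq, Finset.mul_sum]
  simp

/-- The product Hermite functions as Schwartz functions. -/
def hermTest (hħ : 0 < ħ) (α : Fin d → ℕ) : 𝓢(Rd d, ℂ) :=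
  SchwartzMap.bilinLeftCLM (ContinuousLinearMap.lsmul ℝ ℝ : ℝ →L[ℝ] ℂ →L[ℝ] ℂ)
    (g := fun x => ((∏ j, (hermPoly ħ (α j)).eval (x j) : ℝ) : ℂ))
    (Function.HasTemperateGrowth.comp Function.Complex.hasTemperateGrowth_ofReal (hasTemperateGrowth_prod Finset.univ fun j =>
      hasTemperateGrowth_polynomial_eval
        (EuclideanSpace.proj (𝕜 := ℝ) j).hasTemperateGrowth (hermPoly ħ (α j))))
    (gaussian (Rd d) (show 0 < 1 / (2 * ħ) by positivity))

theorem hermTest_apply (hħ : 0 < ħ) (α : Fin d → ℕ) (x : Rd d) :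
    hermTest hħ α x = (hermProd ħ α x : ℂ) := by
  rw [hermTest, SchwartzMap.bilinLeftCLM_apply, hermProd_eq]
  simp only [gaussian_apply, ContinuousLinearMap.lsmul_apply, Complex.real_smul]
  push_cast
  ring

theorem hasDerivAt_deriv_hermFun (hħ : 0 < ħ) (n : ℕ) (x : ℝ) :
    HasDerivAt (fun x => (x * hermFun ħ n x - hermFun ħ (n + 1) x) / ħ)
      ((x ^ 2 - (2 * n + 1) * ħ) / ħ ^ 2 * hermFun ħ n x) x := by
  have h1 := (hasDerivAt_id x).mul (hasDerivAt_hermFun hħ n x)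
  refine ((h1.sub (hasDerivAt_hermFun' hħ (n + 1) x)).div_const ħ).congr_deriv ?_
  simp only [id, Nat.add_sub_cancel]
  push_cast
  field_simp
  ring

theorem oscillator_hermTest (hħ : 0 < ħ) (α : Fin d → ℕ) :
    oscillator d ħ (hermTest hħ α) = ((energy d ħ (∑ j, α j) : ℝ) : ℂ) • hermTest hħ α := by
  have hfun : (hermTest hħ α : Rd d → ℂ)
      = fun y => ((∏ i, hermFun ħ (α i) (y i) : ℝ) : ℂ) := funext (hermTest_apply hħ α)
  ext x
  rw [oscillator_apply, hfun, smul_apply, hermTest_apply]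
  have hterm : ∀ j : Fin d, -((ħ : ℂ) ^ 2 / 2) *
        lineDeriv ℝ (fun y => lineDeriv ℝ (fun y : Rd d =>
            ((∏ i, hermFun ħ (α i) (y i) : ℝ) : ℂ)) y
          (EuclideanSpace.single j 1)) x (EuclideanSpace.single j 1)
      + ((x j : ℂ) ^ 2 / 2) * ((∏ i, hermFun ħ (α i) (x i) : ℝ) : ℂ)
      = ((ħ * (α j + 1 / 2) : ℝ) : ℂ) * (hermProd ħ α x : ℂ) := by
    intro j
    set G : Fin d → ℝ → ℝ := Function.update (fun i => hermFun ħ (α i)) j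
      (fun t => (t * hermFun ħ (α j) t - hermFun ħ (α j + 1) t) / ħ) with hG
    have h1 : (fun y : Rd d => lineDeriv ℝ (fun y : Rd d =>
        ((∏ i, hermFun ħ (α i) (y i) : ℝ) : ℂ)) y (EuclideanSpace.single j 1))
        = fun y => ((∏ i, G i (y i) : ℝ) : ℂ) := by
      funext y
      rw [lineDeriv_prod_coord (hasDerivAt_hermFun hħ (α j) (y j)),
        ← Finset.mul_prod_erase _ _ (Finset.mem_univ j)]
      congr 2
      · simp [hG]
      · refine Finset.prod_congr rfl fun i hi => ?_
        rw [hG, Function.update_of_ne (Finset.ne_of_mem_erase hi)]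
    have h2 : HasDerivAt (G j) (((x j) ^ 2 - (2 * α j + 1) * ħ) / ħ ^ 2 * hermFun ħ (α j) (x j))
        (x j) := by
      rw [hG, Function.update_self]
      exact hasDerivAt_deriv_hermFun hħ (α j) (x j)
    have h3 : ∏ i ∈ Finset.univ.erase j, G i (x i)
        = ∏ i ∈ Finset.univ.erase j, hermFun ħ (α i) (x i) :=
      Finset.prod_congr rfl fun i hi => by
        rw [hG, Function.update_of_ne (Finset.ne_of_mem_erase hi)]
    rw [h1, lineDeriv_prod_coord h2, h3, hermProd, ← Finset.mul_prod_erase _ _ (Finset.mem_univ j)]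
    have hc : (ħ : ℂ) ≠ 0 := by exact_mod_cast hħ.ne'
    push_cast
    field_simp
    ring
  rw [Finset.sum_congr rfl fun j _ => hterm j, ← Finset.sum_mul, smul_eq_mul]
  congr 1
  rw [← Complex.ofReal_sum, ← Finset.mul_sum, Finset.sum_add_distrib, energy,
    Finset.sum_const, Finset.card_univ, Fintype.card_fin, nsmul_eq_mul, Nat.cast_sum, mul_one_div]

/-- A Schwartz function as an element of `L²`. -/
def toL2 (φ : 𝓢(Rd d, ℂ)) : L2 d := φ.toLp 2

theorem toL2_eq (φ : 𝓢(Rd d, ℂ)) :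
    toL2 φ = SchwartzMap.toLpCLM ℂ ℂ 2 (volume : Measure (Rd d)) φ := rfl

theorem toL2_add (φ ψ : 𝓢(Rd d, ℂ)) : toL2 (φ + ψ) = toL2 φ + toL2 ψ := by
  simp only [toL2_eq, map_add]

theorem toL2_smul (c : ℂ) (φ : 𝓢(Rd d, ℂ)) : toL2 (c • φ) = c • toL2 φ := by
  simp only [toL2_eq, map_smul]

theorem toL2_real_smul (c : ℝ) (φ : 𝓢(Rd d, ℂ)) : toL2 (c • φ) = (c : ℂ) • toL2 φ := by
  rw [← toL2_smul]
  congr 1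

theorem toL2_sum {ι : Type*} (S : Finset ι) (φ : ι → 𝓢(Rd d, ℂ)) :
    toL2 (∑ i ∈ S, φ i) = ∑ i ∈ S, toL2 (φ i) := by
  simp only [toL2_eq, map_sum]

theorem inner_toL2 (φ ψ : 𝓢(Rd d, ℂ)) :
    inner ℂ (toL2 φ) (toL2 ψ) = ∫ x, (starRingEnd ℂ) (φ x) * ψ x := by
  rw [toL2, toL2, SchwartzMap.inner_toL2_toL2_eq φ ψ volume]
  simp only [RCLike.inner_apply, mul_comm]

theorem inner_lineDerivOp (φ ψ : 𝓢(Rd d, ℂ)) (v : Rd d) :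
    inner ℂ (toL2 (∂_{v} φ)) (toL2 ψ) = -inner ℂ (toL2 φ) (toL2 (∂_{v} ψ)) := by
  have h := SchwartzMap.integral_bilinear_lineDerivOp_right_eq_neg_left (μ := volume) φ ψ
    ((ContinuousLinearMap.mul ℝ ℂ).comp (Complex.conjCLE : ℂ →L[ℝ] ℂ)) v
  simp only [ContinuousLinearMap.comp_apply, ContinuousLinearMap.mul_apply',
    ContinuousLinearEquiv.coe_coe, Complex.conjCLE_apply] at h
  rw [inner_toL2, inner_toL2, h, neg_neg]

theorem inner_smulLeftCLM {g : Rd d → ℝ} (hg : g.HasTemperateGrowth) (φ ψ : 𝓢(Rd d, ℂ)) :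
    inner ℂ (toL2 (SchwartzMap.smulLeftCLM ℂ g φ)) (toL2 ψ)
      = inner ℂ (toL2 φ) (toL2 (SchwartzMap.smulLeftCLM ℂ g ψ)) := by
  rw [inner_toL2, inner_toL2]
  refine integral_congr_ae (Eventually.of_forall fun x => ?_)
  simp only [SchwartzMap.smulLeftCLM_apply_apply hg, Complex.real_smul,
    map_mul, Complex.conj_ofReal]
  ring

theorem toL2_oscillator (φ : 𝓢(Rd d, ℂ)) : toL2 (oscillator d ħ φ) =
    ∑ j : Fin d, (((-(ħ ^ 2 / 2) : ℝ) : ℂ) •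
      toL2 (∂_{EuclideanSpace.single j (1 : ℝ)} (∂_{EuclideanSpace.single j (1 : ℝ)} φ))
      + toL2 (SchwartzMap.smulLeftCLM ℂ (fun x : Rd d => x j ^ 2 / 2) φ)) := by
  rw [oscillator, toL2_sum]
  refine Finset.sum_congr rfl fun j _ => ?_
  rw [toL2_add, toL2_real_smul]

theorem hasTemperateGrowth_coord_sq (j : Fin d) :
    (fun x : Rd d => x j ^ 2 / 2).HasTemperateGrowth :=
  ((EuclideanSpace.proj (𝕜 := ℝ) j).hasTemperateGrowth.pow 2).mul
    (Function.HasTemperateGrowth.const (2⁻¹ : ℝ))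

/-- The oscillator is symmetric on Schwartz functions. -/
theorem inner_oscillator (φ ψ : 𝓢(Rd d, ℂ)) :
    inner ℂ (toL2 (oscillator d ħ φ)) (toL2 ψ) = inner ℂ (toL2 φ) (toL2 (oscillator d ħ ψ)) := by
  rw [toL2_oscillator, toL2_oscillator, sum_inner, inner_sum]
  refine Finset.sum_congr rfl fun j _ => ?_
  rw [inner_add_left, inner_add_right, inner_smul_left, inner_smul_right, Complex.conj_ofReal,
    inner_lineDerivOp, inner_lineDerivOp, neg_neg,
    inner_smulLeftCLM (hasTemperateGrowth_coord_sq j)]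

theorem mem_eigenspace_iff {E : ℝ} {f : L2 d} : f ∈ eigenspace d ħ E ↔
    ∀ φ : 𝓢(Rd d, ℂ), inner ℂ (toL2 (oscillator d ħ φ)) f = (E : ℂ) * inner ℂ (toL2 φ) f :=
  Iff.rfl

/-- The product Hermite functions as elements of `L²`. -/
def hermL2 (hħ : 0 < ħ) (α : Fin d → ℕ) : L2 d := toL2 (hermTest hħ α)

theorem coeFn_hermL2 (hħ : 0 < ħ) (α : Fin d → ℕ) :
    (hermL2 hħ α : Rd d → ℂ) =ᵐ[volume] fun x => (hermProd ħ α x : ℂ) := by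
  filter_upwards [(hermTest hħ α).coeFn_toLp 2] with x hx
  rw [hermL2, toL2, hx, hermTest_apply]

theorem inner_hermL2 (hħ : 0 < ħ) (α : Fin d → ℕ) (f : L2 d) :
    inner ℂ (hermL2 hħ α) f = ∫ x, (hermProd ħ α x : ℂ) * f x := by
  rw [L2.inner_def]
  refine integral_congr_ae ?_
  filter_upwards [coeFn_hermL2 hħ α] with x hx
  rw [hx, RCLike.inner_apply, Complex.conj_ofReal, mul_comm]

theorem integrable_hermProd_mul (hħ : 0 < ħ) (α : Fin d → ℕ) (f : L2 d) :
    Integrable fun x => (hermProd ħ α x : ℂ) * f x := by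
  have h := L2.integrable_inner (𝕜 := ℂ) (hermL2 hħ α) f
  refine h.congr ?_
  filter_upwards [coeFn_hermL2 hħ α] with x hx
  rw [hx, RCLike.inner_apply, Complex.conj_ofReal, mul_comm]

/-- The squared norm of `hermL2 hħ α`. -/
def hermProdNormSq (ħ : ℝ) (α : Fin d → ℕ) : ℝ := ∏ j, hermNormSq ħ (α j)

theorem hermProdNormSq_pos (hħ : 0 < ħ) (α : Fin d → ℕ) : 0 < hermProdNormSq ħ α :=
  Finset.prod_pos fun j _ => hermNormSq_pos hħ (α j)

theorem inner_hermL2_hermL2 (hħ : 0 < ħ) (α β : Fin d → ℕ) :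
    inner ℂ (hermL2 hħ α) (hermL2 hħ β) = if α = β then (hermProdNormSq ħ β : ℂ) else 0 := by
  have h1 : inner ℂ (hermL2 hħ α) (hermL2 hħ β)
      = ∫ x : Rd d, ∏ j, ((hermFun ħ (α j) (x j) * hermFun ħ (β j) (x j) : ℝ) : ℂ) := by
    rw [inner_hermL2]
    refine integral_congr_ae ?_
    filter_upwards [coeFn_hermL2 hħ β] with x hx
    rw [hx, hermProd, hermProd]
    push_cast
    rw [Finset.prod_mul_distrib]
  rw [h1, integral_prod_coord
    fun j t => ((hermFun ħ (α j) t * hermFun ħ (β j) t : ℝ) : ℂ)]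
  simp only [integral_complex_ofReal, integral_hermFun_mul hħ]
  by_cases hαβ : α = β
  · simp [hαβ, hermProdNormSq]
  · rw [if_neg hαβ]
    obtain ⟨j, hj⟩ := Function.ne_iff.mp hαβ
    exact Finset.prod_eq_zero (Finset.mem_univ j) (by simp [hj])

theorem hermL2_mem_eigenspace (hħ : 0 < ħ) (α : Fin d → ℕ) :
    hermL2 hħ α ∈ eigenspace d ħ (energy d ħ (∑ j, α j)) := by
  rw [mem_eigenspace_iff]
  intro φ
  rw [hermL2, inner_oscillator, oscillator_hermTest, toL2_smul, inner_smul_right]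

theorem energy_injective (hħ : 0 < ħ) {m n : ℕ} (h : energy d ħ m = energy d ħ n) : m = n := by
  have := mul_left_cancel₀ hħ.ne' h
  exact_mod_cast add_right_cancel this

/-- Hermite functions are admissible test functions in the distributional eigenvalue equation, so
distinct eigenvalues give orthogonality without any discussion of operator domains. -/
theorem inner_hermL2_of_mem_eigenspace (hħ : 0 < ħ) {N : ℕ} {f : L2 d}
    (hf : f ∈ eigenspace d ħ (energy d ħ N)) (α : Fin d → ℕ) (hα : ∑ j, α j ≠ N) :
    inner ℂ (hermL2 hħ α) f = 0 := by
  have h := mem_eigenspace_iff.mp hf (hermTest hħ α)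
  rw [oscillator_hermTest, toL2_smul, inner_smul_left, Complex.conj_ofReal, ← hermL2] at h
  have h2 : (((energy d ħ (∑ j, α j) : ℝ) : ℂ) - ((energy d ħ N : ℝ) : ℂ))
      * inner ℂ (hermL2 hħ α) f = 0 := by rw [sub_mul, h, sub_self]
  refine (mul_eq_zero.mp h2).resolve_left fun h3 => hα (energy_injective (d := d) hħ ?_)
  exact_mod_cast sub_eq_zero.mp h3

end

end WignerOsc
-- Completeness of the Hermite system.
namespace WignerOsc

noncomputable section

section FourierUniqueness

open FourierTransform
open scoped ContDiff

variable {V : Type*} [NormedAddCommGroup V] [InnerProductSpace ℝ V] [MeasurableSpace V]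
  [BorelSpace V] [FiniteDimensional ℝ V]

/-- An integrable function with vanishing Fourier transform vanishes almost everywhere. -/
theorem ae_eq_zero_of_fourier_eq_zero {f : V → ℂ} (hf : Integrable f) (h : ∀ w, 𝓕 f w = 0) :
    ∀ᵐ x, f x = 0 := by
  refine ae_eq_zero_of_integral_contDiff_smul_eq_zero hf.locallyIntegrable fun g hg hgs => ?_
  have hgc : HasCompactSupport fun x => (g x : ℂ) := hgs.comp_left Complex.ofReal_zero
  have hgd : ContDiff ℝ ∞ fun x => (g x : ℂ) := Complex.ofRealCLM.contDiff.comp hg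
  set φ : 𝓢(V, ℂ) := hgc.toSchwartzMap hgd
  set χ : 𝓢(V, ℂ) := 𝓕⁻ φ
  have hχ : 𝓕 (χ : V → ℂ) = fun x => (g x : ℂ) := by
    rw [← SchwartzMap.fourier_coe]
    have : 𝓕 χ = φ := fourier_fourierInv_eq φ
    rw [this]
    rfl
  have key : ∫ w, 𝓕 f w • χ w = ∫ x, f x • 𝓕 (χ : V → ℂ) x := by
    have := VectorFourier.integral_fourierIntegral_smul_eq_flip (L := innerₗ V) (μ := volume)
      (ν := volume) Real.continuous_fourierChar continuous_inner hf χ.integrable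
    rw [flip_innerₗ] at this
    exact this
  simp only [h, zero_smul, integral_zero, hχ] at key
  rw [key]
  refine integral_congr_ae (Eventually.of_forall fun x => ?_)
  simp [mul_comm]

end FourierUniqueness

variable {d : ℕ} {ħ : ℝ}

theorem coord_mul_hermProd (α : Fin d → ℕ) (j : Fin d) (x : Rd d) :
    x j * hermProd ħ α x = 1 / 2 * hermProd ħ (Function.update α j (α j + 1)) x
      + α j * ħ * hermProd ħ (Function.update α j (α j - 1)) x := by
  have h : ∀ m, hermProd ħ (Function.update α j m) x
      = hermFun ħ m (x j) * ∏ i ∈ Finset.univ.erase j, hermFun ħ (α i) (x i) := by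
    intro m
    rw [hermProd, ← Finset.mul_prod_erase _ _ (Finset.mem_univ j), Function.update_self]
    congr 1
    exact Finset.prod_congr rfl fun i hi => by
      rw [Function.update_of_ne (Finset.ne_of_mem_erase hi)]
  rw [h, h, hermProd, ← Finset.mul_prod_erase _ _ (Finset.mem_univ j)]
  linear_combination (∏ i ∈ Finset.univ.erase j, hermFun ħ (α i) (x i)) *
    mul_hermFun (ħ := ħ) (α j) (x j)

/-- The span of the product Hermite functions. -/
def hermSpan (d : ℕ) (ħ : ℝ) : Submodule ℝ (Rd d → ℝ) :=
  Submodule.span ℝ (Set.range (hermProd ħ))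

theorem hermProd_mem_hermSpan (α : Fin d → ℕ) : hermProd ħ α ∈ hermSpan d ħ :=
  Submodule.subset_span ⟨α, rfl⟩

theorem coord_mul_mem_hermSpan (j : Fin d) {f : Rd d → ℝ} (hf : f ∈ hermSpan d ħ) :
    (fun x => x j * f x) ∈ hermSpan d ħ := by
  induction hf using Submodule.span_induction with
  | mem f hf =>
    obtain ⟨α, rfl⟩ := hf
    have : (fun x : Rd d => x j * hermProd ħ α x)
        = (1 / 2 : ℝ) • hermProd ħ (Function.update α j (α j + 1))
          + (α j * ħ) • hermProd ħ (Function.update α j (α j - 1)) := by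
      funext x
      exact coord_mul_hermProd α j x
    rw [this]
    exact add_mem (Submodule.smul_mem _ _ (hermProd_mem_hermSpan _))
      (Submodule.smul_mem _ _ (hermProd_mem_hermSpan _))
  | zero =>
    simp only [Pi.zero_apply, mul_zero]
    exact (hermSpan d ħ).zero_mem
  | add f g _ _ hf hg =>
    simp only [Pi.add_apply, mul_add]
    exact add_mem hf hg
  | smul a f _ hf =>
    have : (fun x : Rd d => x j * (a • f) x) = a • fun x : Rd d => x j * f x := by
      funext x
      simp only [Pi.smul_apply, smul_eq_mul]
      ring
    rw [this]
    exact Submodule.smul_mem _ _ hf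

theorem inner_mul_mem_hermSpan (w : Rd d) {f : Rd d → ℝ} (hf : f ∈ hermSpan d ħ) :
    (fun x => inner ℝ x w * f x) ∈ hermSpan d ħ := by
  have : (fun x : Rd d => inner ℝ x w * f x) = ∑ j, w j • fun x : Rd d => x j * f x := by
    funext x
    simp only [PiLp.inner_apply, Finset.sum_apply, Pi.smul_apply, smul_eq_mul, Finset.sum_mul,
      RCLike.inner_apply, conj_trivial, mul_assoc]
  rw [this]
  exact sum_mem fun j _ => Submodule.smul_mem _ _ (coord_mul_mem_hermSpan j hf)

/-- Applied to the Gaussian, these are, up to constants, the Taylor terms of a plane wave times the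
Gaussian. -/
theorem inner_pow_mul_mem_hermSpan (w : Rd d) {f : Rd d → ℝ} (hf : f ∈ hermSpan d ħ) (n : ℕ) :
    (fun x => inner ℝ x w ^ n * f x) ∈ hermSpan d ħ := by
  induction n with
  | zero => simpa using hf
  | succ n ih =>
    simp only [pow_succ', mul_assoc]
    exact inner_mul_mem_hermSpan w ih

theorem integral_hermSpan_mul (hħ : 0 < ħ) {ψ : L2 d}
    (hψ : ∀ α : Fin d → ℕ, inner ℂ (hermL2 hħ α) ψ = 0) {f : Rd d → ℝ} (hf : f ∈ hermSpan d ħ) :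
    Integrable (fun x => (f x : ℂ) * ψ x) ∧ ∫ x, (f x : ℂ) * ψ x = 0 := by
  induction hf using Submodule.span_induction with
  | mem f hf =>
    obtain ⟨α, rfl⟩ := hf
    exact ⟨integrable_hermProd_mul hħ α ψ, by rw [← inner_hermL2 hħ, hψ]⟩
  | zero => simp
  | add f g _ _ hf hg =>
    simp only [Pi.add_apply, Complex.ofReal_add, add_mul]
    exact ⟨hf.1.add hg.1, by rw [integral_add hf.1 hg.1, hf.2, hg.2, add_zero]⟩
  | smul a f _ hf =>
    simp only [Pi.smul_apply, smul_eq_mul, Complex.ofReal_mul, mul_assoc]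
    exact ⟨hf.1.const_mul _, by rw [integral_const_mul, hf.2, mul_zero]⟩

theorem hermProd_zero_apply (x : Rd d) :
    hermProd ħ (0 : Fin d → ℕ) x = Real.exp (-(1 / (2 * ħ)) * ‖x‖ ^ 2) := by
  rw [hermProd_eq]
  simp [hermPoly]

/-- Half of the Gaussian exponent absorbs the exponential by completing the square; the other half
is square integrable and pairs with `ψ`. This dominates the plane wave series. -/
theorem integrable_exp_mul_hermProd_zero (hħ : 0 < ħ) (ψ : L2 d) (c : ℝ) :
    Integrable fun x : Rd d => Real.exp (c * ‖x‖) * ‖(hermProd ħ (0 : Fin d → ℕ) x : ℂ) * ψ x‖ := by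
  have ha : 0 < 1 / (4 * ħ) := by positivity
  have h1 : Integrable fun x => gaussian (Rd d) ha x * ‖ψ x‖ :=
    ((gaussian (Rd d) ha).memLp 2 volume).integrable_mul (Lp.memLp ψ).norm
  refine (h1.const_mul (Real.exp (c ^ 2 * ħ))).mono' ?_ (Eventually.of_forall fun x => ?_)
  · refine Continuous.aestronglyMeasurable (by fun_prop) |>.mul ?_
    exact (integrable_hermProd_mul hħ 0 ψ).aestronglyMeasurable.norm
  · have h2 : c * ‖x‖ + -(1 / (2 * ħ)) * ‖x‖ ^ 2 ≤ c ^ 2 * ħ + -(1 / (4 * ħ)) * ‖x‖ ^ 2 := by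
      have h3 : c ^ 2 * ħ + -(1 / (4 * ħ)) * ‖x‖ ^ 2 - (c * ‖x‖ + -(1 / (2 * ħ)) * ‖x‖ ^ 2)
          = (2 * ħ * c - ‖x‖) ^ 2 / (4 * ħ) := by
        field_simp
        ring
      have h4 : 0 ≤ (2 * ħ * c - ‖x‖) ^ 2 / (4 * ħ) := by positivity
      linarith
    rw [Real.norm_of_nonneg (by positivity), norm_mul, hermProd_zero_apply, Complex.norm_real,
      Real.norm_of_nonneg (Real.exp_pos _).le, gaussian_apply, ← mul_assoc, ← mul_assoc,
      ← Real.exp_add, ← Real.exp_add]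
    gcongr

/-- The product Hermite functions form a complete system in `L²`. -/
theorem eq_zero_of_inner_hermL2 (hħ : 0 < ħ) {ψ : L2 d}
    (hψ : ∀ α : Fin d → ℕ, inner ℂ (hermL2 hħ α) ψ = 0) : ψ = 0 := by
  -- All moments `⟨x, w⟩ⁿ` of Gaussian times `ψ` vanish, hence, term by term, so does its Fourier
  -- transform; the Gaussian has no zeros.
  set F : Rd d → ℂ := fun x => (hermProd ħ (0 : Fin d → ℕ) x : ℂ) * ψ x with hF
  have hFi : Integrable F := integrable_hermProd_mul hħ 0 ψ
  have hfour : ∀ w, FourierTransform.fourier F w = 0 := by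
    intro w
    rw [Real.fourier_eq']
    have hexp : ∀ z : ℂ, HasSum (fun n : ℕ => z ^ n / (n.factorial : ℂ)) (Complex.exp z) := by
      intro z
      rw [Complex.exp_eq_exp_ℂ]
      exact NormedSpace.expSeries_div_hasSum_exp z
    have hexpr : ∀ t : ℝ, HasSum (fun n : ℕ => t ^ n / (n.factorial : ℝ)) (Real.exp t) := by
      intro t
      rw [Real.exp_eq_exp_ℝ]
      exact NormedSpace.expSeries_div_hasSum_exp t
    have hsum := hasSum_integral_of_dominated_convergence (μ := (volume : Measure (Rd d)))
      (F := fun (n : ℕ) x => ((((-2 * Real.pi * inner ℝ x w : ℝ) : ℂ) * Complex.I) ^ n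
        / (n.factorial : ℂ)) • F x)
      (f := fun x => Complex.exp (((-2 * Real.pi * inner ℝ x w : ℝ) : ℂ) * Complex.I) • F x)
      (fun n x => |-2 * Real.pi * inner ℝ x w| ^ n / (n.factorial : ℝ) * ‖F x‖)
      (fun n => (by fun_prop : Continuous fun x : Rd d =>
        (((-2 * Real.pi * inner ℝ x w : ℝ) : ℂ) * Complex.I) ^ n
          / (n.factorial : ℂ)).aestronglyMeasurable.smul hFi.aestronglyMeasurable)
      (fun n => Eventually.of_forall fun x => by
        rw [norm_smul, norm_div, norm_pow, norm_mul, Complex.norm_I, mul_one, Complex.norm_real,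
          Real.norm_eq_abs, Complex.norm_natCast])
      (Eventually.of_forall fun x => (hexpr _).summable.mul_right _)
      (by
        have h1 : (fun x : Rd d => ∑' n : ℕ, |-2 * Real.pi * inner ℝ x w| ^ n
            / (n.factorial : ℝ) * ‖F x‖)
            = fun x => Real.exp |-2 * Real.pi * inner ℝ x w| * ‖F x‖ := by
          funext x
          exact ((hexpr _).mul_right _).tsum_eq
        rw [h1]
        refine (integrable_exp_mul_hermProd_zero hħ ψ (2 * Real.pi * ‖w‖)).mono'
          ((Continuous.aestronglyMeasurable (by fun_prop)).mul hFi.aestronglyMeasurable.norm)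
          (Eventually.of_forall fun x => ?_)
        rw [Real.norm_of_nonneg (by positivity)]
        have h2 : |-2 * Real.pi * inner ℝ x w| ≤ 2 * Real.pi * ‖w‖ * ‖x‖ := by
          rw [abs_mul, abs_mul, abs_neg, abs_of_pos Real.pi_pos, abs_of_pos (two_pos : (0 : ℝ) < 2)]
          have := abs_real_inner_le_norm x w
          have hpi := Real.pi_pos
          calc 2 * Real.pi * |inner ℝ x w| ≤ 2 * Real.pi * (‖x‖ * ‖w‖) := by gcongr
            _ = _ := by ring
        gcongr)
      (Eventually.of_forall fun x => (hexp _).smul_const _)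
    have hzero : ∀ n : ℕ, ∫ x, ((((-2 * Real.pi * inner ℝ x w : ℝ) : ℂ) * Complex.I) ^ n
        / (n.factorial : ℂ)) • F x = 0 := by
      intro n
      have h1 := (integral_hermSpan_mul hħ hψ (inner_pow_mul_mem_hermSpan w
        (hermProd_mem_hermSpan (0 : Fin d → ℕ)) n)).2
      have h2 : (fun x => ((((-2 * Real.pi * inner ℝ x w : ℝ) : ℂ) * Complex.I) ^ n
          / (n.factorial : ℂ)) • F x) = fun x => ((-2 * Real.pi * Complex.I) ^ n / n.factorial) *
            (((inner ℝ x w ^ n * hermProd ħ (0 : Fin d → ℕ) x : ℝ) : ℂ) * ψ x) := by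
        funext x
        simp only [hF, smul_eq_mul]
        push_cast
        rw [show (-2 * (Real.pi : ℂ) * ((inner ℝ x w : ℝ) : ℂ) * Complex.I)
          = (-2 * Real.pi * Complex.I) * ((inner ℝ x w : ℝ) : ℂ) by ring, mul_pow]
        ring
      rw [h2, integral_const_mul, h1, mul_zero]
    simp only [hzero] at hsum
    exact (hasSum_zero.unique hsum).symm
  have h0 := ae_eq_zero_of_fourier_eq_zero hFi hfour
  refine (Lp.eq_zero_iff_ae_eq_zero).mpr ?_
  filter_upwards [h0] with x hx
  refine (mul_eq_zero.mp hx).resolve_left ?_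
  rw [hermProd_zero_apply]
  exact_mod_cast (Real.exp_pos _).ne'

/-! ### Spectral projections, their kernels and Wigner distributions. -/

/-- The orthogonal projection onto the span of the Hermite functions of degree `N`. -/
def hermProj (hħ : 0 < ħ) (N : ℕ) (f : L2 d) : L2 d :=
  ∑ l ∈ Finset.finsuppAntidiag (Finset.univ : Finset (Fin d)) N,
    ((hermProdNormSq ħ l : ℂ)⁻¹ * inner ℂ (hermL2 hħ l) f) • hermL2 hħ l

theorem hermProj_mem_eigenspace (hħ : 0 < ħ) (N : ℕ) (f : L2 d) :
    hermProj hħ N f ∈ eigenspace d ħ (energy d ħ N) := by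
  refine sum_mem fun l hl => Submodule.smul_mem _ _ ?_
  have h := hermL2_mem_eigenspace (d := d) hħ l
  rwa [(Finset.mem_finsuppAntidiag.mp hl).1] at h

theorem inner_hermL2_hermProj (hħ : 0 < ħ) {N : ℕ} (f : L2 d) (α : Fin d → ℕ)
    (hα : ∑ j, α j = N) : inner ℂ (hermL2 hħ α) (hermProj hħ N f) = inner ℂ (hermL2 hħ α) f := by
  have hne : (hermProdNormSq ħ α : ℂ) ≠ 0 := by exact_mod_cast (hermProdNormSq_pos hħ α).ne'
  rw [hermProj, inner_sum, Finset.sum_eq_single (Finsupp.equivFunOnFinite.symm α)]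
  · rw [inner_smul_right, inner_hermL2_hermL2]
    simp only [Finsupp.coe_equivFunOnFinite_symm, if_true]
    field_simp
  · intro l _ hl
    rw [inner_smul_right, inner_hermL2_hermL2, if_neg, mul_zero]
    intro h
    apply hl
    ext j
    simp [h]
  · intro h
    exact absurd (Finset.mem_finsuppAntidiag.mpr ⟨by simpa using hα, Finset.subset_univ _⟩) h

/-- The difference is orthogonal to Hermite functions of degree `N` by construction and to the
others because it lies in the eigenspace; completeness kills it. -/
theorem eq_hermProj_of_mem_eigenspace (hħ : 0 < ħ) {N : ℕ} {f : L2 d}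
    (hf : f ∈ eigenspace d ħ (energy d ħ N)) : f = hermProj hħ N f := by
  rw [← sub_eq_zero]
  refine eq_zero_of_inner_hermL2 hħ fun α => ?_
  by_cases hα : ∑ j, α j = N
  · rw [inner_sub_right, inner_hermL2_hermProj hħ f α hα, sub_self]
  · exact inner_hermL2_of_mem_eigenspace hħ
      (sub_mem hf (hermProj_mem_eigenspace hħ N f)) α hα

theorem eigenProjection_eq (hħ : 0 < ħ) (N : ℕ) (f : L2 d) :
    eigenProjection d ħ (energy d ħ N) f = hermProj hħ N f := by
  refine Submodule.eq_starProjection_of_mem_of_inner_eq_zero (hermProj_mem_eigenspace hħ N f)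
    fun w hw => ?_
  have h : ∀ l ∈ Finset.finsuppAntidiag (Finset.univ : Finset (Fin d)) N,
      inner ℂ (f - hermProj hħ N f) (hermL2 hħ l) = 0 := fun l hl => by
    rw [← inner_conj_symm, inner_sub_right,
      inner_hermL2_hermProj hħ f l (Finset.mem_finsuppAntidiag.mp hl).1, sub_self, map_zero]
  generalize f - hermProj hħ N f = r at h
  rw [eq_hermProj_of_mem_eigenspace hħ hw, hermProj, inner_sum]
  refine Finset.sum_eq_zero fun l hl => ?_
  rw [inner_smul_right, h l hl, mul_zero]

/-- The kernel of the projection onto the `N`-th eigenspace. -/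
def hermKernel (ħ : ℝ) (N : ℕ) (x y : Rd d) : ℂ :=
  ∑ l ∈ Finset.finsuppAntidiag (Finset.univ : Finset (Fin d)) N,
    (hermProdNormSq ħ l : ℂ)⁻¹ * ((hermProd ħ l x : ℂ) * (hermProd ħ l y : ℂ))

theorem isContinuousKernel_hermKernel (hħ : 0 < ħ) (N : ℕ) :
    IsContinuousKernel (eigenProjection d ħ (energy d ħ N)) (hermKernel ħ N) := by
  constructor
  · have := fun l : Fin d → ℕ => continuous_hermProd (ħ := ħ) l
    unfold hermKernel
    fun_prop
  · intro f
    set S := Finset.finsuppAntidiag (Finset.univ : Finset (Fin d)) N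
    have h1 := Lp.coeFn_fun_finsetSum S fun l =>
      ((hermProdNormSq ħ l : ℂ)⁻¹ * inner ℂ (hermL2 hħ l) f) • hermL2 hħ l
    have h2 : ∀ᵐ x : Rd d, ∀ l ∈ S, (((hermProdNormSq ħ l : ℂ)⁻¹ * inner ℂ (hermL2 hħ l) f) •
        hermL2 hħ l : L2 d) x
        = ((hermProdNormSq ħ l : ℂ)⁻¹ * inner ℂ (hermL2 hħ l) f) * (hermProd ħ l x : ℂ) := by
      refine (Finset.eventually_all S).mpr fun l _ => ?_
      filter_upwards [Lp.coeFn_smul ((hermProdNormSq ħ l : ℂ)⁻¹ * inner ℂ (hermL2 hħ l) f)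
        (hermL2 hħ l), coeFn_hermL2 hħ l] with x hx hx'
      rw [hx, Pi.smul_apply, hx', smul_eq_mul]
    rw [eigenProjection_eq hħ, hermProj]
    filter_upwards [h1, h2] with x hx hx'
    have hexp : ∀ y, hermKernel ħ N x y * f y = ∑ l ∈ S, ((hermProdNormSq ħ l : ℂ)⁻¹ *
        (hermProd ħ l x : ℂ)) * ((hermProd ħ l y : ℂ) * f y) := by
      intro y
      rw [hermKernel, Finset.sum_mul]
      exact Finset.sum_congr rfl fun l _ => by ring
    have hint : ∀ l ∈ S, Integrable fun y => ((hermProdNormSq ħ l : ℂ)⁻¹ *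
        (hermProd ħ l x : ℂ)) * ((hermProd ħ l y : ℂ) * f y) :=
      fun l _ => (integrable_hermProd_mul hħ l f).const_mul _
    simp only [hexp]
    refine ⟨integrable_finsetSum S hint, ?_⟩
    rw [integral_finsetSum S hint, hx]
    refine Finset.sum_congr rfl fun l hl => ?_
    rw [hx' l hl, integral_const_mul, inner_hermL2]
    ring

theorem hermProd_cross_eq (α : Fin d → ℕ) (x ξ v : Rd d) :
    ((hermProd ħ α (x + (1 / 2 : ℝ) • v) : ℂ) * (hermProd ħ α (x - (1 / 2 : ℝ) • v) : ℂ)) *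
      Complex.exp (-(Complex.I / (ħ : ℂ)) * ((inner ℝ v ξ : ℝ) : ℂ))
      = ∏ j, hermCross ħ (α j) (α j) (x j) (ξ j) (v j) := by
  have h : ((inner ℝ v ξ : ℝ) : ℂ) = ∑ j, ((v j * ξ j : ℝ) : ℂ) := by
    rw [← Complex.ofReal_sum]
    congr 1
    simp [PiLp.inner_apply, mul_comm]
  simp only [hermCross, hermProd]
  rw [h, Finset.mul_sum, Complex.exp_sum, Finset.prod_mul_distrib]
  push_cast
  rw [Finset.prod_mul_distrib]
  simp

/-- The Wigner distribution of an eigenspace projection in terms of Laguerre polynomials. -/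
theorem wigner_eq (hħ : 0 < ħ) (N : ℕ) (x ξ : Rd d) :
    wigner d ħ N x ξ = ((2 * Real.pi * ħ : ℝ) : ℂ)⁻¹ ^ d *
      ((2 ^ d * (Real.exp (-(4 * hamiltonian x ξ / ħ / 2)) *
        genLag d N (4 * hamiltonian x ξ / ħ)) : ℝ) : ℂ) := by
  rw [wigner, (isContinuousKernel_hermKernel hħ N).kernel_eq, wignerTransform]
  congr 1
  set S := Finset.finsuppAntidiag (Finset.univ : Finset (Fin d)) N
  have hint : ∀ l ∈ S, Integrable fun v : Rd d => (hermProdNormSq ħ l : ℂ)⁻¹ *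
      ∏ j, hermCross ħ (l j) (l j) (x j) (ξ j) (v j) := fun l _ =>
    (integrable_prod_coord fun j => integrable_hermCross hħ (l j) (l j) (x j) (ξ j)).const_mul _
  have hexp : ∀ v : Rd d, hermKernel ħ N (x + (1 / 2 : ℝ) • v) (x - (1 / 2 : ℝ) • v) *
      Complex.exp (-(Complex.I / (ħ : ℂ)) * ((inner ℝ v ξ : ℝ) : ℂ))
      = ∑ l ∈ S, (hermProdNormSq ħ l : ℂ)⁻¹ *
        ∏ j, hermCross ħ (l j) (l j) (x j) (ξ j) (v j) := by
    intro v
    rw [hermKernel, Finset.sum_mul]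
    exact Finset.sum_congr rfl fun l _ => by rw [← hermProd_cross_eq, mul_assoc]
  simp only [hexp]
  rw [integral_finsetSum S hint]
  have hs : ∑ j, 2 * ((x j) ^ 2 + (ξ j) ^ 2) / ħ = 4 * hamiltonian x ξ / ħ := by
    rw [← Finset.sum_div, ← Finset.mul_sum, Finset.sum_add_distrib, hamiltonian,
      EuclideanSpace.norm_sq_eq, EuclideanSpace.norm_sq_eq]
    simp only [Real.norm_eq_abs, sq_abs]
    ring
  have hs' : ∑ j, -(((x j) ^ 2 + (ξ j) ^ 2) / ħ) = -(4 * hamiltonian x ξ / ħ / 2) := by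
    rw [← hs, Finset.sum_neg_distrib, Finset.sum_div]
    congr 1
    exact Finset.sum_congr rfl fun j _ => by ring
  have hterm : ∀ l ∈ S, ∫ v : Rd d, (hermProdNormSq ħ l : ℂ)⁻¹ *
      ∏ j, hermCross ħ (l j) (l j) (x j) (ξ j) (v j)
      = ((2 ^ d * Real.exp (-(4 * hamiltonian x ξ / ħ / 2)) *
        ∏ j, lag (l j) (2 * ((x j) ^ 2 + (ξ j) ^ 2) / ħ) : ℝ) : ℂ) := by
    intro l _
    rw [integral_const_mul, integral_prod_coord fun j => hermCross ħ (l j) (l j) (x j) (ξ j)]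
    change _ * ∏ j, hermWigner ħ (l j) (l j) (x j) (ξ j) = _
    rw [← hs', Real.exp_sum, hermProdNormSq, Complex.ofReal_prod, ← Finset.prod_inv_distrib,
      ← Finset.prod_mul_distrib]
    simp only [inv_mul_eq_div, hermWigner_div_normSq hħ]
    rw [← Complex.ofReal_prod, Finset.prod_mul_distrib, Finset.prod_mul_distrib]
    simp [mul_assoc]
  rw [Finset.sum_congr rfl hterm, ← Complex.ofReal_sum, ← Finset.mul_sum, sum_prod_lag, hs,
    mul_assoc]

end

end WignerOsc
-- Semiclassical sums and the three regimes.
namespace WignerOsc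

noncomputable section

/-- The Wigner distribution of the `N`-th eigenspace projection, multiplied by `(2πħ)ᵈ`, on the
energy surface `H = h`. -/
def scaledWigner (d : ℕ) (h ħ : ℝ) (N : ℕ) : ℝ :=
  2 ^ d * (Real.exp (-(4 * h / ħ / 2)) * genLag d N (4 * h / ħ))

theorem eventually_pos_and_le {c : ℝ} (hc : 0 < c) : ∀ᶠ ħ : ℝ in 𝓝[>] 0, 0 < ħ ∧ ħ ≤ c := by
  filter_upwards [Ioo_mem_nhdsGT hc] with ħ hħ
  exact ⟨hħ.1, hħ.2.le⟩

theorem bulkWigner_eq {d : ℕ} {ħ : ℝ} (hħ : 0 < ħ) (E₁ E₂ : ℝ) (x ξ : Rd d) :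
    bulkWigner d ħ E₁ E₂ x ξ = ((2 * Real.pi * ħ : ℝ) : ℂ)⁻¹ ^ d *
      ((∑ N ∈ (finite_window d hħ E₁ E₂).toFinset, scaledWigner d (hamiltonian x ξ) ħ N : ℝ) : ℂ) := by
  rw [bulkWigner, finsum_mem_eq_finite_toFinset_sum _ (finite_window d hħ E₁ E₂),
    Complex.ofReal_sum, Finset.mul_sum]
  exact Finset.sum_congr rfl fun N _ => wigner_eq hħ N x ξ

theorem exists_pow_mul_geometric_le {r : ℝ} (h0 : 0 < r) (h1 : r < 1) (k : ℕ) :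
    ∃ K : ℝ, 0 ≤ K ∧ ∀ j : ℕ, ((j : ℝ) + 3) ^ k * r ^ j ≤ K := by
  have h := tendsto_pow_const_mul_const_pow_of_abs_lt_one k (by rwa [abs_of_pos h0] : |r| < 1)
  obtain ⟨K, hK⟩ := h.bddAbove_range
  have hK' : ∀ j : ℕ, (j : ℝ) ^ k * r ^ j ≤ K := fun j => hK ⟨j, rfl⟩
  have hK0 : 0 ≤ K := le_trans (by positivity) (hK' 1)
  refine ⟨K / r ^ 3, by positivity, fun j => ?_⟩
  rw [le_div_iff₀ (by positivity), mul_assoc, ← pow_add]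
  exact_mod_cast hK' (j + 3)

/-- Eigenvalues below the energy of the phase space point contribute `O(ħ^∞)`. -/
theorem exists_forbidden_sum_bound (d : ℕ) {h E : ℝ} (hh : 0 < h) (hE : E < h) (n : ℕ) :
    ∃ C : ℝ, ∀ᶠ ħ : ℝ in 𝓝[>] 0, ∀ T : Finset ℕ, (∀ N ∈ T, energy d ħ N ≤ E) →
      |∑ N ∈ T, scaledWigner d h ħ N| ≤ C * ħ ^ n := by
  set E₀ : ℝ := max E 0 with hE₀
  have hE₀0 : 0 ≤ E₀ := le_max_right _ _
  have hE₀h : E₀ < h := max_lt hE hh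
  set E' : ℝ := (E₀ + h) / 2 with hE'
  have hE'0 : 0 < E' := by linarith
  have hE'h : E' < h := by linarith
  set Δ : ℝ := E' - E₀ with hΔ
  have hΔ0 : 0 < Δ := by linarith
  set κ : ℝ := 4 * h / E' - 4 with hκ
  have hκ0 : 0 < κ := by
    have : 4 < 4 * h / E' := by
      rw [lt_div_iff₀ hE'0]
      linarith
    linarith
  -- With `η = min 1 κ` one has `(2 + η)²/(1 + η) ≤ 4 + η² ≤ 4 + κ`, so this rate is admissible up
  -- to energy `E'`.
  set ρ : ℝ := 1 + min 1 κ with hρdef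
  have hη0 : 0 < min 1 κ := lt_min one_pos hκ0
  have hρ : 1 < ρ := by linarith
  have hρ4 : (ρ + 1) ^ 2 / ρ ≤ 4 * h / E' := by
    have h1 := min_le_left 1 κ
    have h2 := min_le_right 1 κ
    rw [div_le_iff₀ (by linarith), show 4 * h / E' = κ + 4 by rw [hκ]; ring]
    nlinarith
  obtain ⟨C, hC, hbound⟩ := exists_genLag_forbidden_bound d hρ
  -- The extra power of `ħ` pays for the `O(1/ħ)` eigenvalues in the sum.
  obtain ⟨K, hK, hgeo⟩ := exists_pow_mul_geometric_le (r := 1 / ρ) (by positivity)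
    (by rw [div_lt_one (by linarith)]; exact hρ) (n + 1)
  refine ⟨(E₀ + 1) * (2 ^ d * (C * (K / Δ ^ (n + 1)))), ?_⟩
  filter_upwards [eventually_pos_and_le one_pos, eventually_pos_and_le hΔ0,
    eventually_pos_and_le hh] with ħ hħ1 hħ2 hħ3 T hT
  obtain ⟨hħ, hħ1⟩ := hħ1
  -- About `Δ/ħ` degrees separate the cut from `E'`; the `-1` makes room for `N + j + 1` in
  -- `hbound`.
  set j : ℕ := ⌊Δ / ħ - 1⌋₊ with hj
  have hΔħ : 1 ≤ Δ / ħ := by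
    rw [le_div_iff₀ hħ]
    linarith [hħ2.2]
  have hj1 : (j : ℝ) + 1 ≤ Δ / ħ := by
    have := Nat.floor_le (by linarith : 0 ≤ Δ / ħ - 1)
    linarith
  have hj2 : Δ / ħ ≤ (j : ℝ) + 3 := by
    have := Nat.lt_floor_add_one (Δ / ħ - 1)
    linarith
  have hs1 : 1 ≤ 4 * h / ħ := by
    rw [le_div_iff₀ hħ]
    linarith [hħ3.2]
  have hN : ∀ N ∈ T, (N : ℝ) ≤ E₀ / ħ := by
    intro N hN
    rw [le_div_iff₀ hħ]
    have h1 := (hT N hN).trans (le_max_left E 0)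
    have h2 : 0 ≤ ħ * ((d : ℝ) / 2) := by positivity
    rw [energy] at h1
    nlinarith
  have hgeoj : (1 / ρ) ^ j ≤ K / Δ ^ (n + 1) * ħ ^ (n + 1) := by
    have h1 : (Δ / ħ) ^ (n + 1) * (1 / ρ) ^ j ≤ K := by
      refine le_trans ?_ (hgeo j)
      gcongr
    rw [div_pow] at h1
    rw [div_mul_eq_mul_div, le_div_iff₀ (by positivity)]
    rw [div_mul_eq_mul_div, div_le_iff₀ (by positivity)] at h1
    linarith
  have hterm : ∀ N ∈ T, |scaledWigner d h ħ N| ≤ 2 ^ d * (C * (K / Δ ^ (n + 1) * ħ ^ (n + 1))) := by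
    intro N hNT
    rw [scaledWigner, abs_mul, abs_of_pos (by positivity : (0 : ℝ) < 2 ^ d)]
    gcongr
    refine (hbound N j _ hs1 ?_).trans (by gcongr)
    have h1 : ((N + j + 1 : ℕ) : ℝ) ≤ E' / ħ := by
      have h2 := hN N hNT
      have h3 : E₀ / ħ + Δ / ħ = E' / ħ := by
        rw [hΔ]
        ring
      push_cast
      linarith
    calc (ρ + 1) ^ 2 / ρ * ((N + j + 1 : ℕ) : ℝ) ≤ 4 * h / E' * (E' / ħ) := by gcongr
      _ = 4 * h / ħ := by field_simp
  have hcard : (T.card : ℝ) ≤ (E₀ + 1) / ħ := by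
    have h1 : T ⊆ Finset.range (⌊E₀ / ħ⌋₊ + 1) := fun N hNT =>
      Finset.mem_range_succ_iff.mpr (Nat.le_floor (hN N hNT))
    have h2 : (T.card : ℝ) ≤ (⌊E₀ / ħ⌋₊ : ℝ) + 1 := by
      have := Finset.card_le_card h1
      rw [Finset.card_range] at this
      exact_mod_cast this
    have h3 := Nat.floor_le (by positivity : 0 ≤ E₀ / ħ)
    have h4 : 1 ≤ 1 / ħ := by
      rw [le_div_iff₀ hħ]
      linarith
    rw [add_div]
    linarith
  calc |∑ N ∈ T, scaledWigner d h ħ N| ≤ ∑ N ∈ T, |scaledWigner d h ħ N| :=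
        Finset.abs_sum_le_sum_abs _ _
    _ ≤ T.card * (2 ^ d * (C * (K / Δ ^ (n + 1) * ħ ^ (n + 1)))) := by
        rw [← nsmul_eq_mul]
        exact Finset.sum_le_card_nsmul _ _ _ hterm
    _ ≤ (E₀ + 1) / ħ * (2 ^ d * (C * (K / Δ ^ (n + 1) * ħ ^ (n + 1)))) := by gcongr
    _ = _ := by
        rw [pow_succ ħ]
        field_simp

/-- If the energy cut lies above the energy of the phase space point, the sum over all eigenvalues
below the cut is `1 + O(ħ ^ (1/2))`. -/
theorem exists_allowed_sum_bound (d : ℕ) {h E : ℝ} (hh : 0 < h) (hE : h < E) :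
    ∃ C : ℝ, ∀ᶠ ħ : ℝ in 𝓝[>] 0, ∀ m : ℕ, E / ħ - d / 2 - 1 ≤ m → m ≤ E / ħ →
      |∑ N ∈ Finset.range (m + 1), scaledWigner d h ħ N - 1| ≤ C * Real.sqrt ħ := by
  have hE0 : 0 < E := hh.trans hE
  have hd : (0 : ℝ) ≤ d := Nat.cast_nonneg d
  -- The ratio `s/ν` tends to `h/E`; the midpoint to 1 leaves a margin that absorbs the bounded
  -- offset of `m` from `E/ħ` for small `ħ`.
  set b : ℝ := (h / E + 1) / 2 with hb
  have hb1 : b < 1 := by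
    have : h / E < 1 := (div_lt_one hE0).mpr hE
    linarith
  have hbE : E * b = (h + E) / 2 := by
    rw [hb]
    field_simp
  obtain ⟨K, hK, hbound⟩ := exists_genLagSum_bound d (a := h / (2 * E)) (by positivity) hb1
  refine ⟨K / Real.sqrt (4 * h), ?_⟩
  filter_upwards [eventually_pos_and_le hh,
    eventually_pos_and_le (show 0 < (E - h) / (d + 1) from div_pos (by linarith) (by positivity)),
    eventually_pos_and_le (show 0 < E / (d + 2) by positivity)] with ħ h1 h2 h3 m hm1 hm2
  obtain ⟨hħ, h1⟩ := h1
  have h2 := h2.2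
  have h3 := h3.2
  rw [le_div_iff₀ (by positivity)] at h2 h3
  have hs1 : 1 ≤ 4 * h / ħ := by
    rw [le_div_iff₀ hħ]
    linarith
  have hEħ : (d : ℝ) + 2 ≤ E / ħ := by
    rw [le_div_iff₀ hħ]
    linarith
  have hm : 1 ≤ m := by
    have : (1 : ℝ) ≤ m := by linarith
    exact_mod_cast this
  have ha : h / (2 * E) * (4 * m + 2) ≤ 4 * h / ħ := by
    have h4 : (4 * m + 2 : ℝ) ≤ 8 * E / ħ := by
      have : 8 * E / ħ = 8 * (E / ħ) := by ring
      rw [this]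
      linarith
    calc h / (2 * E) * (4 * m + 2) ≤ h / (2 * E) * (8 * E / ħ) := by gcongr
      _ = 4 * h / ħ := by
        field_simp
        norm_num
  have hb2 : 4 * h / ħ ≤ b * (4 * m + 2) := by
    have hb0 : 0 < b := by positivity
    have h4 : b * (4 * (E / ħ) - 2 * (d + 1)) ≤ b * (4 * m + 2) := by
      gcongr
      linarith
    refine le_trans ?_ h4
    have h5 : b * (4 * (E / ħ) - 2 * (d + 1)) = (2 * (h + E)) / ħ - 2 * b * (d + 1) := by
      rw [show b * (4 * (E / ħ) - 2 * (d + 1)) = 4 * (E * b) / ħ - 2 * b * (d + 1) by ring, hbE]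
      ring
    have h6 : (2 * (h + E)) / ħ - 4 * h / ħ = 2 * ((E - h) / ħ) := by ring
    have h7 : (d : ℝ) + 1 ≤ (E - h) / ħ := by
      rw [le_div_iff₀ hħ]
      linarith
    rw [h5]
    nlinarith
  have h4 := hbound m (4 * h / ħ) hm hs1 ha hb2
  have h5 : ∑ N ∈ Finset.range (m + 1), scaledWigner d h ħ N
      = 2 ^ d * (Real.exp (-(4 * h / ħ / 2)) * genLagSum d (m + 1) (4 * h / ħ)) := by
    rw [genLagSum, Finset.mul_sum, Finset.mul_sum]
    rfl
  rw [h5]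
  refine h4.trans ?_
  have h6 : 4 * h / ħ ≤ 4 * m + 2 := by nlinarith [(Nat.cast_nonneg m : (0 : ℝ) ≤ m)]
  calc K / Real.sqrt (4 * m + 2) ≤ K / Real.sqrt (4 * h / ħ) := by gcongr
    _ = K / Real.sqrt (4 * h) * Real.sqrt ħ := by
      rw [Real.sqrt_div (by positivity)]
      field_simp

theorem energy_le_iff {d : ℕ} {ħ : ℝ} (hħ : 0 < ħ) (E : ℝ) (N : ℕ) :
    energy d ħ N ≤ E ↔ (N : ℝ) ≤ E / ħ - d / 2 := by
  rw [energy, le_sub_iff_add_le, le_div_iff₀ hħ, mul_comm]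

theorem sum_window_eq {d : ℕ} {ħ E₁ E₂ : ℝ} (hħ : 0 < ħ) (h₂ : (d : ℝ) / 2 ≤ E₂ / ħ)
    (f : ℕ → ℝ) :
    ∑ N ∈ (finite_window d hħ E₁ E₂).toFinset, f N
      = ∑ N ∈ Finset.range (⌊E₂ / ħ - d / 2⌋₊ + 1), f N
        - ∑ N ∈ Finset.range (⌊E₂ / ħ - d / 2⌋₊ + 1) with energy d ħ N < E₁, f N := by
  have hmem : ∀ N : ℕ, N ∈ Finset.range (⌊E₂ / ħ - d / 2⌋₊ + 1) ↔ energy d ħ N ≤ E₂ := by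
    intro N
    rw [Finset.mem_range_succ_iff, Nat.le_floor_iff (by linarith), energy_le_iff hħ]
  rw [eq_sub_iff_add_eq, add_comm, ← Finset.sum_filter_add_sum_filter_not
    (Finset.range (⌊E₂ / ħ - d / 2⌋₊ + 1)) (fun N => energy d ħ N < E₁)]
  congr 1
  refine Finset.sum_congr ?_ fun _ _ => rfl
  ext N
  rw [Set.Finite.mem_toFinset, Finset.mem_filter, hmem, not_lt, Set.mem_ofPred_eq, Set.mem_Icc,
    and_comm]

/-- An eigenvalue equal to `E₁` belongs to the window, so the removed part stops at the ceiling
minus one. -/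
theorem filter_energy_lt_eq {d : ℕ} {ħ E₁ E₂ : ℝ} (hħ : 0 < ħ) (h₁ : (d : ℝ) / 2 < E₁ / ħ)
    (hE : E₁ ≤ E₂) :
    (Finset.range (⌊E₂ / ħ - d / 2⌋₊ + 1)).filter (fun N => energy d ħ N < E₁)
      = Finset.range ((⌈E₁ / ħ - d / 2⌉₊ - 1) + 1) := by
  have hpos : 0 < ⌈E₁ / ħ - d / 2⌉₊ := Nat.ceil_pos.mpr (by linarith)
  have hE' : E₁ / ħ ≤ E₂ / ħ := by gcongr
  ext N
  have hlt : energy d ħ N < E₁ ↔ (N : ℝ) < E₁ / ħ - d / 2 := by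
    rw [energy, lt_sub_iff_add_lt, lt_div_iff₀ hħ, mul_comm]
  rw [Finset.mem_filter, Finset.mem_range_succ_iff, Nat.le_floor_iff (by linarith), hlt,
    Nat.sub_add_cancel hpos, Finset.mem_range, Nat.lt_ceil]
  exact ⟨fun h => h.2, fun h => ⟨by linarith, h⟩⟩

theorem eventually_half_lt_div (d : ℕ) {E : ℝ} (hE : 0 < E) :
    ∀ᶠ ħ : ℝ in 𝓝[>] 0, 0 < ħ ∧ (d : ℝ) / 2 < E / ħ := by
  filter_upwards [eventually_pos_and_le (show 0 < E / (d + 1) by positivity)] with ħ hħ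
  refine ⟨hħ.1, ?_⟩
  have h := hħ.2
  rw [le_div_iff₀ (by positivity)] at h
  rw [lt_div_iff₀ hħ.1]
  nlinarith [hħ.1, (Nat.cast_nonneg d : (0 : ℝ) ≤ d)]

theorem exists_upper_sum_bound (d : ℕ) {h E : ℝ} (hh : 0 < h) (hE : h < E) :
    ∃ C : ℝ, ∀ᶠ ħ : ℝ in 𝓝[>] 0,
      |∑ N ∈ Finset.range (⌊E / ħ - d / 2⌋₊ + 1), scaledWigner d h ħ N - 1|
        ≤ C * Real.sqrt ħ := by
  obtain ⟨C, hC⟩ := exists_allowed_sum_bound d hh hE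
  refine ⟨C, ?_⟩
  filter_upwards [hC, eventually_half_lt_div d (hh.trans hE)] with ħ hC hħ
  have hd : (0 : ℝ) ≤ d := Nat.cast_nonneg d
  refine hC _ ?_ ?_
  · linarith [Nat.lt_floor_add_one (E / ħ - d / 2)]
  · linarith [Nat.floor_le (by linarith [hħ.2] : 0 ≤ E / ħ - d / 2)]

theorem exists_lower_sum_bound (d : ℕ) {h E : ℝ} (hh : 0 < h) (hE : h < E) :
    ∃ C : ℝ, ∀ᶠ ħ : ℝ in 𝓝[>] 0,
      |∑ N ∈ Finset.range ((⌈E / ħ - d / 2⌉₊ - 1) + 1), scaledWigner d h ħ N - 1|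
        ≤ C * Real.sqrt ħ := by
  obtain ⟨C, hC⟩ := exists_allowed_sum_bound d hh hE
  refine ⟨C, ?_⟩
  filter_upwards [hC, eventually_half_lt_div d (hh.trans hE)] with ħ hC hħ
  have hd : (0 : ℝ) ≤ d := Nat.cast_nonneg d
  have hpos : 1 ≤ ⌈E / ħ - d / 2⌉₊ := Nat.ceil_pos.mpr (by linarith [hħ.2])
  refine hC _ ?_ ?_
  · rw [Nat.cast_sub hpos, Nat.cast_one]
    linarith [Nat.le_ceil (E / ħ - d / 2)]
  · rw [Nat.cast_sub hpos, Nat.cast_one]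
    linarith [Nat.ceil_lt_add_one (by linarith [hħ.2] : 0 ≤ E / ħ - d / 2)]

theorem norm_inv_planck_pow {ħ : ℝ} (hħ : 0 < ħ) (d : ℕ) :
    ‖((2 * Real.pi * ħ : ℝ) : ℂ)⁻¹ ^ d‖ = ((2 * Real.pi) ^ d)⁻¹ * (ħ ^ d)⁻¹ := by
  have := Real.pi_pos
  rw [norm_pow, norm_inv, Complex.norm_real, Real.norm_of_nonneg (by positivity), inv_pow, mul_pow,
    mul_inv]

/-- The levels removed below `E₁` are forbidden, and already `O(ħ)` for them suffices. -/
theorem bulkWigner_interior (d : ℕ) {E₁ E₂ : ℝ} (x ξ : Rd d) (hH : 0 < hamiltonian x ξ)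
    (h₁ : E₁ < hamiltonian x ξ) (h₂ : hamiltonian x ξ < E₂) :
    (fun ħ : ℝ => ((2 * Real.pi * ħ : ℝ) : ℂ) ^ d * bulkWigner d ħ E₁ E₂ x ξ - 1)
      =O[𝓝[>] 0] fun ħ : ℝ => ħ ^ (1 / 2 : ℝ) := by
  obtain ⟨C, hC⟩ := exists_upper_sum_bound d hH h₂
  obtain ⟨C', hC'⟩ := exists_forbidden_sum_bound d hH h₁ 1
  refine IsBigO.of_bound (C + |C'|) ?_
  filter_upwards [hC, hC', eventually_half_lt_div d (hH.trans h₂),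
    eventually_pos_and_le one_pos] with ħ hC hC' hħ hħ1
  obtain ⟨hħ, hħE⟩ := hħ
  have hc : ((2 * Real.pi * ħ : ℝ) : ℂ) ≠ 0 := by
    have := Real.pi_pos
    exact_mod_cast (by positivity : 2 * Real.pi * ħ ≠ 0)
  have h3 := hC' ((Finset.range (⌊E₂ / ħ - d / 2⌋₊ + 1)).filter (fun N => energy d ħ N < E₁))
    fun N hN => (Finset.mem_filter.mp hN).2.le
  rw [bulkWigner_eq hħ, ← mul_assoc, ← mul_pow, mul_inv_cancel₀ hc, one_pow, one_mul,
    ← Complex.ofReal_one, ← Complex.ofReal_sub, Complex.norm_real, sum_window_eq hħ hħE.le,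
    ← Real.sqrt_eq_rpow, Real.norm_eq_abs, Real.norm_of_nonneg (Real.sqrt_nonneg ħ), sub_right_comm]
  have h4 : ħ ≤ Real.sqrt ħ := Real.le_sqrt_of_sq_le (by nlinarith [hħ1.2])
  have h5 : C' * ħ ^ 1 ≤ |C'| * Real.sqrt ħ := by
    rw [pow_one]
    exact mul_le_mul (le_abs_self _) h4 hħ.le (abs_nonneg _)
  refine (abs_sub _ _).trans ?_
  rw [add_mul]
  linarith

/-- Both cuts lie above `H`, so the leading ones cancel and only the remainders meet the prefactor
`ħ⁻ᵈ`. -/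
theorem bulkWigner_below (d : ℕ) {E₁ E₂ : ℝ} (hE : E₁ < E₂) (x ξ : Rd d)
    (hH : 0 < hamiltonian x ξ) (h₁ : hamiltonian x ξ < E₁) :
    (fun ħ : ℝ => bulkWigner d ħ E₁ E₂ x ξ)
      =O[𝓝[>] 0] fun ħ : ℝ => ħ ^ (-(d : ℝ) + 1 / 2) := by
  obtain ⟨C, hC⟩ := exists_upper_sum_bound d hH (h₁.trans hE)
  obtain ⟨C', hC'⟩ := exists_lower_sum_bound d hH h₁
  refine IsBigO.of_bound (((2 * Real.pi) ^ d)⁻¹ * (C + C')) ?_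
  filter_upwards [hC, hC', eventually_half_lt_div d (hH.trans (h₁.trans hE)),
    eventually_half_lt_div d (hH.trans h₁)] with ħ hC hC' hħ hħ1
  obtain ⟨hħ, hħE⟩ := hħ
  have hpi := Real.pi_pos
  rw [bulkWigner_eq hħ, norm_mul, norm_inv_planck_pow hħ, Complex.norm_real,
    sum_window_eq hħ hħE.le, filter_energy_lt_eq hħ hħ1.2 hE.le, Real.norm_eq_abs,
    Real.norm_of_nonneg (Real.rpow_nonneg hħ.le _), Real.rpow_add hħ, Real.rpow_neg hħ.le,
    Real.rpow_natCast, ← Real.sqrt_eq_rpow]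
  have h3 : ∀ a b : ℝ, |a - b| ≤ |a - 1| + |b - 1| := fun a b => by
    have := abs_sub (a - 1) (b - 1)
    rwa [sub_sub_sub_cancel_right] at this
  calc _ ≤ ((2 * Real.pi) ^ d)⁻¹ * (ħ ^ d)⁻¹ * (C * Real.sqrt ħ + C' * Real.sqrt ħ) := by
        gcongr
        exact (h3 _ _).trans (add_le_add hC hC')
    _ = _ := by ring

theorem bulkWigner_above (d : ℕ) {E₁ E₂ : ℝ} (x ξ : Rd d)
    (hH : 0 < hamiltonian x ξ) (h₂ : E₂ < hamiltonian x ξ) (n : ℕ) :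
    (fun ħ : ℝ => bulkWigner d ħ E₁ E₂ x ξ) =O[𝓝[>] 0] fun ħ : ℝ => ħ ^ n := by
  -- The exponent `n + d` compensates the prefactor `(2πħ)⁻ᵈ`.
  obtain ⟨C, hC⟩ := exists_forbidden_sum_bound d hH h₂ (n + d)
  refine IsBigO.of_bound (((2 * Real.pi) ^ d)⁻¹ * C) ?_
  filter_upwards [hC, eventually_pos_and_le one_pos] with ħ hC hħ
  obtain ⟨hħ, -⟩ := hħ
  have hpi := Real.pi_pos
  have h3 := hC (finite_window d hħ E₁ E₂).toFinset fun N hN =>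
    ((finite_window d hħ E₁ E₂).mem_toFinset.mp hN).2
  rw [bulkWigner_eq hħ, norm_mul, norm_inv_planck_pow hħ, Complex.norm_real, Real.norm_eq_abs,
    Real.norm_of_nonneg (by positivity : 0 ≤ ħ ^ n)]
  calc _ ≤ ((2 * Real.pi) ^ d)⁻¹ * (ħ ^ d)⁻¹ * (C * ħ ^ (n + d)) := by gcongr
    _ = _ := by
      rw [pow_add]
      field_simp

end

end WignerOsc

theorem proposition1p5 (d : ℕ) (hd : 1 ≤ d) (E₁ E₂ : ℝ) (hE : E₁ < E₂)
    (x ξ : WignerOsc.Rd d) (hH : 0 < WignerOsc.hamiltonian x ξ) :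
    (WignerOsc.hamiltonian x ξ ∈ Set.Ioo E₁ E₂ →
      (fun ħ : ℝ => ((2 * Real.pi * ħ : ℝ) : ℂ) ^ d * WignerOsc.bulkWigner d ħ E₁ E₂ x ξ - 1)
        =O[𝓝[>] 0] fun ħ : ℝ => ħ ^ (1 / 2 : ℝ)) ∧
    (WignerOsc.hamiltonian x ξ < E₁ →
      (fun ħ : ℝ => WignerOsc.bulkWigner d ħ E₁ E₂ x ξ)
        =O[𝓝[>] 0] fun ħ : ℝ => ħ ^ (-(d : ℝ) + 1 / 2)) ∧
    (E₂ < WignerOsc.hamiltonian x ξ →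
      ∀ n : ℕ, (fun ħ : ℝ => WignerOsc.bulkWigner d ħ E₁ E₂ x ξ)
        =O[𝓝[>] 0] fun ħ : ℝ => ħ ^ n) := by
  exact ⟨fun h => WignerOsc.bulkWigner_interior d x ξ hH h.1 h.2,
    fun h => WignerOsc.bulkWigner_below d hE x ξ hH h,
    fun h n => WignerOsc.bulkWigner_above d x ξ hH h n⟩
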